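/- Let $\mathcal H$ be a real Hilbert space, let $m\ge 2$, and let $A_1,\dots,A_m:\mathcal H\rightrightarrows\mathcal H$ be set-valued operators such that each $A_i$ is maximal $\sigma_i$-comonotone with $\sigma_i\in\mathbb R$, i.e. $\langle x-y,u-v\rangle\ge\sigma_i\|u-v\|^2$ for all $u\in A_i(x)$, $v\in A_i(y)$, and no operator with this property has a graph properly containing that of $A_i$. For an operator $T$ write $\operatorname{zer}T=\{x:0\in T(x)\}$ and $\operatorname{Fix}T=\{x:x\in T(x)\}$; for $\gamma>0$ write $J_{\gamma T}=(\mathrm{Id}+\gamma T)^{-1}$, $J^{\lambda}_{\gamma T}=\lambda J_{\gamma T}+(1-\lambda)\mathrm{Id}$ and ${}^{\gamma}T=\frac1\gamma(\mathrm{Id}-J_{\gamma T})$. On $\mathcal H^{m-1}$ let $\mathbf D=\{(x,\dots,x):x\in\mathcal H\}$, let $N_{\mathbf D}$ be its normal cone operator, and define $$\mathbf F(\mathbf x)=A_1(x_1)\times\cdots\times A_{m-1}(x_{m-1}),\qquad \mathbf G(\mathbf x)=\mathbf K(\mathbf x)+N_{\mathbf D}(\mathbf x),$$ where $\mathbf K(x,\dots,x)=\{\tfrac1{m-1}(v,\dots,v):v\in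 A_m(x)\}$ and $\mathbf K(\mathbf x)=\emptyset$ for $\mathbf x\notin\mathbf D$. Suppose that $\operatorname{zer}(A_1+\cdots+A_m)\ne\emptyset$, $\sigma_m\le 0$ and $\sigma_i+(m-1)\sigma_m\ge 0$ for $i=1,\dots,m-1$. Put $\alpha=\min_{1\le i\le m-1}\sigma_i$ and $\beta=(m-1)\sigma_m$, and let $\gamma,\delta,\lambda,\mu>0$ satisfy $(\lambda-1)(\mu-1)=1$, $\delta=\gamma(\lambda-1)$, and $$\delta=\gamma+2\alpha\ \text{ if }\alpha+\beta=0,\qquad (\gamma+\delta)^2<4(\gamma+\alpha)(\delta+\beta)\ \text{ if }\alpha+\beta>0.$$ Let $0<\kappa<\kappa^*$, where $\kappa^*=1$ if $\alpha+\beta=0$ and $\kappa^*=\dfrac{4(\gamma+\alpha)(\delta+\beta)-(\gamma+\delta)^2}{2(\gamma+\delta)(\alpha+\beta)}$ if $\alpha+\beta>0$. Let $T_{\mathbf F,\mathbf G}=(1-\kappa)\mathrm{Id}+\kappa J^{\mu}_{\delta\mathbf G}J^{\lambda}_{\gamma\mathbf F}$. Then $J_{\gamma\mathbf F}$ and $J_{\delta\mathbf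 G}$ are single-valued with full domain, and for every sequence $(\mathbf x^k,\mathbf y^k,\mathbf z^k)_{k\ge0}$ in $\mathcal H^{m-1}$, with arbitrary $\mathbf x^0$, generated by the adaptive Douglas--Rachford algorithm $$\mathbf y^k\in J_{\gamma\mathbf F}(\mathbf x^k),\quad \mathbf z^k\in J_{\delta\mathbf G}((1-\lambda)\mathbf x^k+\lambda\mathbf y^k),\quad \mathbf x^{k+1}=\mathbf x^k+\kappa\mu(\mathbf z^k-\mathbf y^k),$$ there is $\bar{\mathbf x}\in\operatorname{Fix}T_{\mathbf F,\mathbf G}$ with $J_{\gamma\mathbf F}(\bar{\mathbf x})\in\operatorname{zer}(\mathbf F+\mathbf G)$ such that: (i) $\mathbf x^k\rightharpoonup\bar{\mathbf x}$ weakly; (ii) $\|\mathbf x^k-\mathbf x^{k+1}\|=o(1/\sqrt k)$ and $\|\mathbf y^k-\mathbf y^{k+1}\|=o(1/\sqrt k)$ as $k\to\infty$; (iii) the shadow sequences $(\mathbf y^k)$ and $(\mathbf z^k)$ converge weakly to $J_{\gamma\mathbf F}(\bar{\mathbf x})$; (iv) if $\sigma_i+(m-1)\sigma_m>0$ for all $i=1,\dots,m-1$,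 $0<\kappa<1$, and either (a) $\kappa^*\ge1$, or (b) $\gamma=\delta$, $\lambda=\mu=2$ and $\kappa<\kappa^*$, then $\mathbf x^k-\mathbf y^k$ and $\mathbf x^k-\mathbf z^k$ converge strongly to $\gamma\,{}^{\gamma}\mathbf F(\bar{\mathbf x})=\bar{\mathbf x}-J_{\gamma\mathbf F}(\bar{\mathbf x})$, and $\gamma\,{}^{\gamma}\mathbf F(\bar{\mathbf x})+\operatorname{zer}(\mathbf F+\mathbf G)=\operatorname{Fix}T_{\mathbf F,\mathbf G}$. -/

import Mathlib

open Filter Topology Asymptotics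
open scoped Pointwise RealInnerProductSpace

namespace AdaptiveDR

noncomputable section

section General

variable {E : Type*} [NormedAddCommGroup E] [InnerProductSpace ℝ E]

/-- `A` is `σ`-comonotone: `⟪x - y, u - v⟫ ≥ σ ‖u - v‖²` on its graph. -/
def IsComonotone (σ : ℝ) (A : E → Set E) : Prop :=
  ∀ x, ∀ u ∈ A x, ∀ y, ∀ v ∈ A y, σ * ‖u - v‖ ^ 2 ≤ ⟪x - y, u - v⟫

/-- `A` is maximal `σ`-comonotone: it is `σ`-comonotone, and its graph is not properly
contained in the graph of another `σ`-comonotone operator. -/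
def IsMaximalComonotone (σ : ℝ) (A : E → Set E) : Prop :=
  IsComonotone σ A ∧ ∀ B : E → Set E, IsComonotone σ B → (∀ x, A x ⊆ B x) → ∀ x, B x ⊆ A x

/-- The inverse of a set-valued operator. -/
def inverse (A : E → Set E) : E → Set E := fun u => {x | u ∈ A x}

/-- The zeros of a set-valued operator. -/
def zeros (A : E → Set E) : Set E := {x | 0 ∈ A x}

/-- The fixed points of a set-valued operator. -/
def fixedPoints (T : E → Set E) : Set E := {x | x ∈ T x}

/-- The resolvent `J_{γA} = (Id + γA)⁻¹`. -/
def setResolvent (γ : ℝ) (A : E → Set E) : E → Set E := inverse fun y => {y} + γ • A y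

/-- The Yosida approximation `(1/γ)(Id - J_{γA})`. -/
def yosida (γ : ℝ) (A : E → Set E) : E → Set E := fun x => (1 / γ) • ({x} - setResolvent γ A x)

/-- The relaxed resolvent `lam J_{γA} + (1 - lam) Id`. -/
def relaxedResolvent (γ lam : ℝ) (A : E → Set E) : E → Set E :=
  fun x => lam • setResolvent γ A x + {(1 - lam) • x}

/-- The adaptive Douglas--Rachford operator
`(1 - κ) Id + κ J_{δB}^{mu} J_{γA}^{lam}`. -/
def adrOperator (κ γ δ lam mu : ℝ) (A B : E → Set E) : E → Set E :=
  fun x => {(1 - κ) • x} + κ • ⋃ s ∈ relaxedResolvent γ lam A x, relaxedResolvent δ mu B s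

/-- The sequences `x, y, z` are generated by the adaptive Douglas--Rachford algorithm for
`(A, B)` (from the initial point `x 0`). -/
def IsADRSequence (κ γ δ lam mu : ℝ) (A B : E → Set E) (x y z : ℕ → E) : Prop :=
  ∀ k, y k ∈ setResolvent γ A (x k) ∧
    z k ∈ setResolvent δ B ((1 - lam) • x k + lam • y k) ∧
    x (k + 1) = x k + (κ * mu) • (z k - y k)

/-- The normal cone operator of `C` (empty-valued outside `C`). -/
def normalCone (C : Set E) : E → Set E := fun x => {w | x ∈ C ∧ ∀ y ∈ C, ⟪w, y - x⟫ ≤ 0}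

/-- Weak convergence of a sequence. -/
def WeaklyConverges (x : ℕ → E) (a : E) : Prop :=
  Tendsto (fun k => toWeakSpace ℝ E (x k)) atTop (𝓝 (toWeakSpace ℝ E a))

end General

section Product

variable {H : Type*} [NormedAddCommGroup H] [InnerProductSpace ℝ H]

/-- The Hilbert product space `H ^ n`. -/
abbrev ProdSpace (H : Type*) (n : ℕ) : Type _ := PiLp 2 fun _ : Fin n => H

/-- The constant vector `(a, …, a)`. -/
def constVec (n : ℕ) (a : H) : ProdSpace H n := WithLp.toLp 2 fun _ => a

/-- The diagonal subspace `{(a, …, a) : a ∈ H}` of `H ^ n`. -/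
def diagonal (H : Type*) (n : ℕ) : Set (ProdSpace H n) :=
  Set.range (constVec n)

/-- `𝐅(x₁, …, xₙ) = A₁(x₁) × ⋯ × Aₙ(xₙ)`, for operators `A₁, …, Aₙ, Aₙ₊₁`. -/
def opF {n : ℕ} (A : Fin (n + 1) → H → Set H) : ProdSpace H n → Set (ProdSpace H n) :=
  fun x => {w | ∀ i : Fin n, w i ∈ A i.castSucc (x i)}

/-- `𝐊(a, …, a) = {(1/n)(v, …, v) : v ∈ Aₙ₊₁(a)}`, and `𝐊` is empty-valued off the diagonal. -/
def opK {n : ℕ} (A : Fin (n + 1) → H → Set H) : ProdSpace H n → Set (ProdSpace H n) :=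
  fun x => {w | ∃ a v, x = constVec n a ∧ v ∈ A (Fin.last n) a ∧ w = (1 / (n : ℝ)) • constVec n v}

/-- `𝐆 = 𝐊 + N_D` with `D` the diagonal of `H ^ n`. -/
def opG {n : ℕ} (A : Fin (n + 1) → H → Set H) : ProdSpace H n → Set (ProdSpace H n) :=
  fun x => opK A x + normalCone (diagonal H n) x

end Product

/-- The conditions on the parameters `γ, δ, lam, mu` relative to the comonotonicity moduli
`α, β` of two operators (with `α + β ≥ 0`). -/
def ParameterConditions (γ δ lam mu α β : ℝ) : Prop :=
  (lam - 1) * (mu - 1) = 1 ∧ δ = γ * (lam - 1) ∧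
    (α + β = 0 → δ = γ + 2 * α) ∧
    (0 < α + β → (γ + δ) ^ 2 < 4 * (γ + α) * (δ + β))

open Classical in
/-- The upper bound `κ*` for the relaxation parameter (for `α + β ≥ 0`). -/
def kappaStar (γ δ α β : ℝ) : ℝ :=
  if α + β = 0 then 1
  else (4 * (γ + α) * (δ + β) - (γ + δ) ^ 2) / (2 * (γ + δ) * (α + β))

end

end AdaptiveDR

open AdaptiveDR

/-!
The operator `𝐅` is `α`-comonotone and `𝐆` is `β`-comonotone on the product space: the first because
comonotonicity is inherited by products, the second because `w ∈ 𝐆 (a, …, a)` means exactly that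
`∑ i, w i` is a value of the last operator at `a` (`mem_opG_iff`), and `‖∑ i, w i‖² ≤ n ‖w‖²` while
the last modulus is nonpositive. Their resolvents are everywhere defined by Minty's theorem for
comonotone operators (`IsMaximalComonotone.exists_mem_setResolvent`), a consequence of the
Debrunner–Flor lemma, which in turn follows from a finite-dimensional variational argument and
weak compactness. The rest of the proof concerns two comonotone operators and uses nothing of them
but their resolvents.

From `x` the iteration selects `y = J₁ x`, `a = (x - y) / γ`, the point `s = y - δ a`, then
`z = J₂ s`, `b = (s - z) / δ`, so that `z = y - δ (a + b)`, and it moves to `x - κ (γ + δ) (a + b)`.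
For the differences of two runs, comonotonicity gives
`⟪x, a + b⟫ ≥ (γ + α) ‖a‖² + (γ + δ) ⟪a, b⟫ + (δ + β) ‖b‖²`. The bound `κ < κ*` says that this
quadratic form exceeds `κ (γ + δ) / 2 * ‖a + b‖²` with room to spare, and, if `α + β > 0`, even
after a positive multiple of `‖a‖²` is subtracted (`exists_quadratic_bound`). Hence each step
decreases `‖x‖²` by a multiple of `‖a + b‖²` and, if `α + β > 0`, of `‖a‖²`
(`exists_adrStep_estimate`). Summing up, `‖a + b‖²` is summable along the iteration, and being
monotone it is `o(1 / k)`; if `α + β > 0`, the Yosida values `a` converge strongly to the same limit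
for every fixed point, which yields the last part of the theorem.

Weak convergence of `x` is Opial's argument. That cluster points are fixed points, and that the
shadow sequence converges to the resolvent of the limit, both follow from the demiclosedness
statement `gap_eq_zero_of_weaklyTendsto`: the sum of the two comonotonicity inequalities passes to
the weak limit because `a + b` converges strongly, and it forces the limit of the shadow sequence
to be the resolvent of the limit when tested against suitable values of the two resolvents.
-/

namespace AdaptiveDR

/-! ### Weak limits along filters -/

section Weak

variable {ι E : Type*} [NormedAddCommGroup E] [InnerProductSpace ℝ E]

/-- Weak convergence along an arbitrary filter, tested against the inner product. -/
def WeaklyTendsto (x : ι → E) (l : Filter ι) (a : E) : Prop :=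
  ∀ v, Tendsto (fun i => ⟪x i, v⟫) l (𝓝 ⟪a, v⟫)

lemma weaklyConverges_iff [CompleteSpace E] {x : ℕ → E} {a : E} :
    WeaklyConverges x a ↔ WeaklyTendsto x atTop a := by
  refine (WeakBilin.tendsto_iff_forall_eval_tendsto (B := (topDualPairing ℝ E).flip) ?_).trans ?_
  · intro u v huv
    refine ext_inner_left ℝ fun w => ?_
    exact DFunLike.congr_fun huv (InnerProductSpace.toDual ℝ E w)
  · constructor
    · intro h v
      have := h (InnerProductSpace.toDual ℝ E v)
      simp_rw [real_inner_comm v]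
      exact this
    · intro h f
      obtain ⟨v, rfl⟩ := (InnerProductSpace.toDual ℝ E).surjective f
      have := h v
      simp_rw [real_inner_comm v] at this
      exact this

/-- Bounded families in a Hilbert space converge weakly along every ultrafilter. -/
lemma exists_weaklyTendsto [CompleteSpace E] (U : Ultrafilter ι) {x : ι → E} {C : ℝ}
    (hx : ∀ᶠ i in (U : Filter ι), ‖x i‖ ≤ C) : ∃ a, WeaklyTendsto x U a := by
  let f : ι → WeakDual ℝ E := fun i => StrongDual.toWeakDual (InnerProductSpace.toDual ℝ E (x i))
  have hK := WeakDual.isCompact_closedBall (𝕜 := ℝ) (E := E) 0 C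
  obtain ⟨φ, -, hφ⟩ := hK.ultrafilter_le_nhds' (U.map f) (by
    rw [Ultrafilter.mem_map]
    filter_upwards [hx] with i hi
    simp only [Set.mem_preimage, mem_closedBall_zero_iff]
    exact ((InnerProductSpace.toDual ℝ E).norm_map (x i)).le.trans hi)
  refine ⟨(InnerProductSpace.toDual ℝ E).symm (WeakDual.toStrongDual φ), fun v => ?_⟩
  rw [InnerProductSpace.toDual_symm_apply]
  exact ((WeakDual.eval_continuous v).tendsto φ).comp (show Tendsto f U (𝓝 φ) from hφ)

lemma WeaklyTendsto.mono {x : ι → E} {l l' : Filter ι} {a : E} (h : WeaklyTendsto x l a)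
    (hl : l' ≤ l) : WeaklyTendsto x l' a := fun v => (h v).mono_left hl

lemma WeaklyTendsto.const_smul {x : ι → E} {l : Filter ι} {a : E} (hx : WeaklyTendsto x l a)
    (c : ℝ) : WeaklyTendsto (fun i => c • x i) l (c • a) := fun v => by
  simpa only [inner_smul_left, RCLike.conj_to_real] using (hx v).const_mul c

lemma WeaklyTendsto.sub {x y : ι → E} {l : Filter ι} {a b : E} (hx : WeaklyTendsto x l a)
    (hy : WeaklyTendsto y l b) : WeaklyTendsto (fun i => x i - y i) l (a - b) := fun v => by
  simpa only [inner_sub_left] using (hx v).sub (hy v)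

lemma weaklyTendsto_of_tendsto {x : ι → E} {l : Filter ι} {a : E} (hx : Tendsto x l (𝓝 a)) :
    WeaklyTendsto x l a := fun _ => hx.inner tendsto_const_nhds

/-- A bounded family all of whose weak cluster points equal `a` converges weakly to `a`. -/
lemma weaklyTendsto_of_ultrafilter [CompleteSpace E] {x : ι → E} {l : Filter ι} {C : ℝ} {a : E}
    (hC : ∀ᶠ i in l, ‖x i‖ ≤ C)
    (h : ∀ U : Ultrafilter ι, ↑U ≤ l → ∀ b, WeaklyTendsto x U b → b = a) :
    WeaklyTendsto x l a := fun v => by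
  refine (tendsto_iff_ultrafilter _ _ _).2 fun U hU => ?_
  obtain ⟨b, hb⟩ := exists_weaklyTendsto U (hU hC)
  exact h U hU b hb ▸ hb v

/-- Opial's lemma: if the distances of the bounded sequence `x` to the points of `S` converge and
all weak cluster points of `x` lie in the nonempty set `S`, then `x` converges weakly to a point
of `S`. -/
lemma exists_weaklyTendsto_of_opial [CompleteSpace E] {x : ℕ → E} {S : Set E} {C : ℝ}
    (hC : ∀ k, ‖x k‖ ≤ C)
    (hS : ∀ p ∈ S, ∃ d : ℝ, Tendsto (fun k => ‖x k - p‖ ^ 2) atTop (𝓝 d))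
    (h : ∀ U : Ultrafilter ℕ, ↑U ≤ (atTop : Filter ℕ) → ∀ b, WeaklyTendsto x U b → b ∈ S) :
    ∃ a ∈ S, WeaklyTendsto x atTop a := by
  obtain ⟨a, ha⟩ := exists_weaklyTendsto (hyperfilter ℕ) (.of_forall hC)
  have hU : ↑(hyperfilter ℕ) ≤ (atTop : Filter ℕ) := by
    rw [← Nat.cofinite_eq_atTop]; exact hyperfilter_le_cofinite
  have haS := h _ hU a ha
  refine ⟨a, haS, weaklyTendsto_of_ultrafilter (.of_forall hC) fun V hV b hb => ?_⟩
  obtain ⟨d, hd⟩ := hS a haS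
  obtain ⟨e, he⟩ := hS b (h V hV b hb)
  -- `⟪x k, b - a⟫` is an affine function of the difference of the two squared distances.
  have key : Tendsto (fun k => ⟪x k, b - a⟫) atTop (𝓝 ((d - e + (‖b‖ ^ 2 - ‖a‖ ^ 2)) / 2)) := by
    refine (((hd.sub he).add_const (‖b‖ ^ 2 - ‖a‖ ^ 2)).div_const 2).congr fun k => ?_
    rw [norm_sub_sq_real, norm_sub_sq_real, inner_sub_right]; ring
  have h1 := tendsto_nhds_unique (ha (b - a)) (key.mono_left hU)
  have h2 := tendsto_nhds_unique (hb (b - a)) (key.mono_left hV)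
  have h3 : ⟪b - a, b - a⟫ = 0 := by rw [inner_sub_left, h1, h2, sub_self]
  exact sub_eq_zero.1 (inner_self_eq_zero.1 h3)

end Weak

/-! ### Minty's theorem for comonotone operators -/

section Minty

variable {ι E : Type*} [NormedAddCommGroup E] [InnerProductSpace ℝ E]

/-- Chebyshev's inequality for antitone families: a weighted mean of inner products is at most the
inner product of the weighted means. -/
lemma sum_inner_le_of_inner_sub_nonpos [Fintype ι] {c d : ι → E} {l : ι → ℝ}
    (hl : l ∈ stdSimplex ℝ ι) (h : ∀ i j, ⟪c i - c j, d i - d j⟫ ≤ 0) :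
    ∑ i, l i * ⟪c i, d i⟫ ≤ ⟪∑ i, l i • c i, ∑ i, l i • d i⟫ := by
  have h0 : ∑ i, ∑ j, l i * l j * ⟪c i - c j, d i - d j⟫ ≤ 0 :=
    Finset.sum_nonpos fun i _ => Finset.sum_nonpos fun j _ =>
      mul_nonpos_of_nonneg_of_nonpos (mul_nonneg (hl.1 i) (hl.1 j)) (h i j)
  have e1 : ∑ i, ∑ j, l i * l j * ⟪c i, d i⟫ = ∑ i, l i * ⟪c i, d i⟫ :=
    Finset.sum_congr rfl fun i _ => by
      rw [← Finset.sum_mul, ← Finset.mul_sum, hl.2, mul_one]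
  have e2 : ∑ i, ∑ j, l i * l j * ⟪c j, d j⟫ = ∑ i, l i * ⟪c i, d i⟫ := by
    rw [Finset.sum_comm, ← e1]
    exact Finset.sum_congr rfl fun i _ => Finset.sum_congr rfl fun j _ => by ring
  have e3 : ∑ i, ∑ j, l i * l j * ⟪c i, d j⟫ = ⟪∑ i, l i • c i, ∑ i, l i • d i⟫ := by
    simp_rw [sum_inner, inner_sum, inner_smul_left, inner_smul_right, RCLike.conj_to_real, mul_assoc]
  have e4 : ∑ i, ∑ j, l i * l j * ⟪c j, d i⟫ = ⟪∑ i, l i • c i, ∑ i, l i • d i⟫ := by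
    rw [Finset.sum_comm, ← e3]
    exact Finset.sum_congr rfl fun i _ => Finset.sum_congr rfl fun j _ => by ring
  have e5 : ∑ i, ∑ j, l i * l j * ⟪c i - c j, d i - d j⟫ =
      ∑ i, ∑ j, l i * l j * ⟪c i, d i⟫ + ∑ i, ∑ j, l i * l j * ⟪c j, d j⟫ -
        ∑ i, ∑ j, l i * l j * ⟪c i, d j⟫ - ∑ i, ∑ j, l i * l j * ⟪c j, d i⟫ := by
    simp_rw [← Finset.sum_add_distrib, ← Finset.sum_sub_distrib]
    refine Finset.sum_congr rfl fun i _ => Finset.sum_congr rfl fun j _ => ?_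
    simp only [inner_sub_left, inner_sub_right]; ring
  linarith

/-- Finitely many of the balls `{x : ⟪x - c i, x - d i⟫ ≤ 0}` have a common point. A common point is
`½ ∑ i, l i • (c i + d i)`, where `l` maximizes over the simplex the minimum in `x` of
`∑ i, l i * ⟪x - c i, x - d i⟫`. -/
lemma exists_forall_inner_nonpos_of_fintype [Fintype ι] [Nonempty ι] {c d : ι → E}
    (h : ∀ i j, ⟪c i - c j, d i - d j⟫ ≤ 0) : ∃ x, ∀ i, ⟪x - c i, x - d i⟫ ≤ 0 := by
  classical
  let φ : (ι → ℝ) → ℝ := fun l =>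
    ∑ i, l i * ⟪c i, d i⟫ - (1 / 4) * ‖∑ i, l i • (c i + d i)‖ ^ 2
  have hφ : Continuous φ := by fun_prop
  obtain ⟨l, hl, hmax⟩ := (isCompact_stdSimplex ℝ ι).exists_isMaxOn
    ⟨_, single_mem_stdSimplex ℝ (Classical.arbitrary ι)⟩ hφ.continuousOn
  set M := ∑ i, l i • (c i + d i) with hM
  set P := ∑ i, l i * ⟪c i, d i⟫ with hP
  have hPM : P ≤ (1 / 4) * ‖M‖ ^ 2 := by
    have h1 := sum_inner_le_of_inner_sub_nonpos hl h
    have h2 : M = ∑ i, l i • c i + ∑ i, l i • d i := by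
      simp_rw [hM, smul_add, Finset.sum_add_distrib]
    have h3 := norm_add_sq_real (∑ i, l i • c i) (∑ i, l i • d i)
    have h4 := norm_sub_sq_real (∑ i, l i • c i) (∑ i, l i • d i)
    have h5 := sq_nonneg ‖∑ i, l i • c i - ∑ i, l i • d i‖
    rw [h2]; linarith
  refine ⟨(1 / 2 : ℝ) • M, fun j => ?_⟩
  -- First-order optimality of `l` in the direction of the vertex `j`.
  have hvar : ∀ t : ℝ, 0 < t → t ≤ 1 → ⟪c j, d j⟫ - P - (1 / 2) * ⟪M, c j + d j - M⟫ ≤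
      t * ((1 / 4) * ‖c j + d j - M‖ ^ 2) := by
    intro t ht ht1
    have hmem : (1 - t) • l + t • Pi.single j (1 : ℝ) ∈ stdSimplex ℝ ι :=
      convex_stdSimplex ℝ ι hl (single_mem_stdSimplex ℝ j) (by linarith) ht.le (by ring)
    have h1 : φ ((1 - t) • l + t • Pi.single j (1 : ℝ)) ≤ φ l := hmax hmem
    have h2 : ∑ i, ((1 - t) • l + t • Pi.single j (1 : ℝ) : ι → ℝ) i * ⟪c i, d i⟫ =
        P + t * (⟪c j, d j⟫ - P) := by
      simp only [Pi.add_apply, Pi.smul_apply, smul_eq_mul, add_mul, Finset.sum_add_distrib,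
        mul_assoc, ← Finset.mul_sum, Pi.single_apply, ite_mul, one_mul, zero_mul,
        Finset.sum_ite_eq', Finset.mem_univ, if_true]
      rw [← hP]; ring
    have h3 : ∑ i, ((1 - t) • l + t • Pi.single j (1 : ℝ) : ι → ℝ) i • (c i + d i) =
        M + t • (c j + d j - M) := by
      simp only [Pi.add_apply, Pi.smul_apply, smul_eq_mul, add_smul, Finset.sum_add_distrib,
        mul_smul, ← Finset.smul_sum, Pi.single_apply, ite_smul, one_smul, zero_smul,
        Finset.sum_ite_eq', Finset.mem_univ, if_true]
      rw [← hM]; module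
    simp only [φ] at h1
    rw [h2, h3, ← hM, ← hP, norm_add_sq_real, inner_smul_right, norm_smul, mul_pow,
      Real.norm_eq_abs, sq_abs] at h1
    refine le_of_mul_le_mul_left ?_ ht
    nlinarith [h1]
  have hopt : ⟪c j, d j⟫ - P - (1 / 2) * ⟪M, c j + d j - M⟫ ≤ 0 := by
    have ht : Tendsto (fun t : ℝ => t * ((1 / 4) * ‖c j + d j - M‖ ^ 2)) (𝓝[>] 0) (𝓝 0) := by
      have : Continuous fun t : ℝ => t * ((1 / 4) * ‖c j + d j - M‖ ^ 2) := by fun_prop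
      simpa using (this.tendsto 0).mono_left nhdsWithin_le_nhds
    refine ge_of_tendsto ht ?_
    filter_upwards [Ioc_mem_nhdsGT (zero_lt_one' ℝ)] with t htt using hvar t htt.1 htt.2
  simp only [inner_sub_left, inner_sub_right, inner_add_right, inner_smul_left, inner_smul_right,
    RCLike.conj_to_real, real_inner_self_eq_norm_sq] at hopt ⊢
  rw [real_inner_comm M (c j)] at *
  linarith

/-- The Debrunner–Flor extension lemma. -/
lemma exists_forall_inner_nonpos [CompleteSpace E] {c d : ι → E}
    (h : ∀ i j, ⟪c i - c j, d i - d j⟫ ≤ 0) : ∃ x, ∀ i, ⟪x - c i, x - d i⟫ ≤ 0 := by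
  classical
  rcases isEmpty_or_nonempty ι with hι | ⟨⟨i₀⟩⟩
  · exact ⟨0, fun i => hι.elim i⟩
  have hfin : ∀ s : Finset ι, ∃ x, ∀ i ∈ s, ⟪x - c i, x - d i⟫ ≤ 0 := by
    intro s
    rcases s.eq_empty_or_nonempty with rfl | hs
    · exact ⟨0, by simp⟩
    have := hs.to_subtype
    obtain ⟨x, hx⟩ := exists_forall_inner_nonpos_of_fintype (ι := s) (c := fun i => c i)
      (d := fun i => d i) fun i j => h i j
    exact ⟨x, fun i hi => hx ⟨i, hi⟩⟩
  choose X hX using hfin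
  let U : Ultrafilter (Finset ι) := Ultrafilter.of atTop
  have hU : ↑U ≤ (atTop : Filter (Finset ι)) := Ultrafilter.of_le _
  have hmem : ∀ i, ∀ᶠ s in (U : Filter (Finset ι)), i ∈ s := fun i =>
    hU ((eventually_ge_atTop {i}).mono fun s hs => hs (Finset.mem_singleton_self i))
  have hbd : ∀ᶠ s in (U : Filter (Finset ι)), ‖X s‖ ≤ 2 * (‖c i₀‖ + ‖d i₀‖) := by
    filter_upwards [hmem i₀] with s hs
    have h1 := hX s i₀ hs
    simp only [inner_sub_left, inner_sub_right, real_inner_self_eq_norm_sq] at h1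
    have h2 := real_inner_le_norm (X s) (d i₀)
    have h3 := real_inner_le_norm (c i₀) (X s)
    have h4 := neg_le_of_abs_le (abs_real_inner_le_norm (c i₀) (d i₀))
    by_contra! hcon
    have h5 := norm_nonneg (c i₀)
    have h6 := norm_nonneg (d i₀)
    nlinarith [mul_pos ((by positivity : 0 ≤ 2 * (‖c i₀‖ + ‖d i₀‖)).trans_lt hcon)
      (sub_pos.2 hcon), mul_nonneg (add_nonneg h5 h6) (sub_pos.2 hcon).le, mul_nonneg h5 h6]
  obtain ⟨x, hx⟩ := exists_weaklyTendsto U hbd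
  refine ⟨x, fun i => ?_⟩
  -- `‖X s‖²` is bounded below by its weakly continuous tangent at `x`.
  have hlim : Tendsto (fun s => 2 * ⟪X s, x⟫ - ‖x‖ ^ 2 - ⟪X s, d i⟫ - ⟪X s, c i⟫ + ⟪c i, d i⟫) U
      (𝓝 (2 * ⟪x, x⟫ - ‖x‖ ^ 2 - ⟪x, d i⟫ - ⟪x, c i⟫ + ⟪c i, d i⟫)) :=
    ((((((hx x).const_mul 2).sub_const _).sub (hx _)).sub (hx _)).add_const _)
  have := le_of_tendsto hlim (b := 0) (by
    filter_upwards [hmem i] with s hs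
    have h1 := hX s i hs
    have h2 := sq_nonneg ‖X s - x‖
    rw [norm_sub_sq_real] at h2
    simp only [inner_sub_left, inner_sub_right, real_inner_self_eq_norm_sq] at h1
    rw [real_inner_comm (X s) (c i)] at h1
    linarith)
  simp only [inner_sub_left, inner_sub_right, real_inner_self_eq_norm_sq] at this ⊢
  rw [real_inner_comm x (c i)]
  linarith

lemma mem_setResolvent {γ : ℝ} (hγ : γ ≠ 0) {A : E → Set E} {p q : E} :
    q ∈ setResolvent γ A p ↔ γ⁻¹ • (p - q) ∈ A q := by
  simp only [setResolvent, inverse, Set.mem_ofPred_eq, Set.singleton_add, Set.image_add_left,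
    Set.mem_preimage]
  rw [Set.mem_smul_set_iff_inv_smul_mem₀ hγ, neg_add_eq_sub]

/-- Minty's theorem: the resolvent of a maximal `σ`-comonotone operator has full domain if
`γ + σ > 0`. -/
lemma IsMaximalComonotone.exists_mem_setResolvent [CompleteSpace E] {σ γ : ℝ} {A : E → Set E}
    (hA : IsMaximalComonotone σ A) (hγ : 0 < γ) (hγσ : 0 < γ + σ) (p : E) :
    ∃ q, q ∈ setResolvent γ A p := by
  let c : {g : E × E // g.2 ∈ A g.1} → E := fun g => g.1.2
  let d : {g : E × E // g.2 ∈ A g.1} → E := fun g =>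
    g.1.2 + (γ + σ)⁻¹ • (p - γ • g.1.2 - g.1.1)
  have hcd : ∀ i j, ⟪c i - c j, d i - d j⟫ ≤ 0 := by
    rintro ⟨⟨x, u⟩, hu⟩ ⟨⟨y, v⟩, hv⟩
    have h1 := hA.1 x u hu y v hv
    have h2 : (γ + σ) • (d ⟨(x, u), hu⟩ - d ⟨(y, v), hv⟩) = σ • (u - v) - (x - y) := by
      simp only [d, smul_sub, smul_add, smul_inv_smul₀ hγσ.ne']
      module
    refine nonpos_of_mul_nonpos_right (a := γ + σ) ?_ hγσ
    rw [← inner_smul_right, h2, inner_sub_right, inner_smul_right, real_inner_self_eq_norm_sq,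
      real_inner_comm]
    linarith
  obtain ⟨u, hu⟩ := exists_forall_inner_nonpos hcd
  have hrel : ∀ y, ∀ v ∈ A y, σ * ‖u - v‖ ^ 2 ≤ ⟪p - γ • u - y, u - v⟫ := by
    intro y v hv
    have h1 := hu ⟨(y, v), hv⟩
    have h2 : (γ + σ) • (u - d ⟨(y, v), hv⟩) = σ • (u - v) - (p - γ • u - y) := by
      simp only [d, smul_sub, smul_add, smul_inv_smul₀ hγσ.ne']
      module
    have h3 := mul_nonpos_of_nonneg_of_nonpos hγσ.le h1
    rw [← inner_smul_right, h2, inner_sub_right, inner_smul_right, real_inner_self_eq_norm_sq,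
      real_inner_comm] at h3
    linarith
  refine ⟨p - γ • u, (mem_setResolvent hγ.ne').2 ?_⟩
  rw [sub_sub_cancel, inv_smul_smul₀ hγ.ne']
  -- Adding the new point to the graph keeps the operator comonotone.
  refine hA.2 (fun x => A x ∪ {w | x = p - γ • u ∧ w = u}) ?_ (fun x => Set.subset_union_left) _
    (Or.inr ⟨rfl, rfl⟩)
  rintro x w (hw | ⟨rfl, rfl⟩) y v (hv | ⟨rfl, rfl⟩)
  · exact hA.1 x w hw y v hv
  · have := hrel x w hw
    rwa [← neg_sub w, ← neg_sub x, inner_neg_neg, norm_neg] at this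
  · exact hrel y v hv
  · simp

/-- A comonotone operator has an at most single-valued resolvent. -/
lemma IsComonotone.setResolvent_subsingleton {σ γ : ℝ} {A : E → Set E} (hA : IsComonotone σ A)
    (hγ : 0 < γ) (hγσ : 0 < γ + σ) (p : E) : (setResolvent γ A p).Subsingleton := by
  intro q hq r hr
  rw [mem_setResolvent hγ.ne'] at hq hr
  have h1 := hA _ _ hq _ _ hr
  have h2 : q - r = -(γ • (γ⁻¹ • (p - q) - γ⁻¹ • (p - r))) := by
    rw [smul_sub, smul_inv_smul₀ hγ.ne', smul_inv_smul₀ hγ.ne']; abel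
  set w := γ⁻¹ • (p - q) - γ⁻¹ • (p - r)
  rw [h2, inner_neg_left, inner_smul_left, real_inner_self_eq_norm_sq, RCLike.conj_to_real] at h1
  have h3 : ‖w‖ = 0 := by
    by_contra hne
    have := pow_pos (lt_of_le_of_ne (norm_nonneg w) (Ne.symm hne)) 2
    nlinarith
  rw [norm_eq_zero.1 h3, smul_zero, neg_zero] at h2
  exact sub_eq_zero.1 h2

end Minty

/-! ### Two facts on real sequences -/

section Sequences

lemma summable_of_add_le {e r : ℕ → ℝ} (he : ∀ k, 0 ≤ e k) (hr : ∀ k, 0 ≤ r k)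
    (h : ∀ k, e (k + 1) + r k ≤ e k) : Summable r := by
  refine summable_of_sum_range_le (c := e 0) hr fun n => ?_
  have : ∑ i ∈ Finset.range n, r i ≤ e 0 - e n := by
    induction n with
    | zero => simp
    | succ n ih => rw [Finset.sum_range_succ]; linarith [h n]
  linarith [he n]

/-- Olivier's theorem for the squares of an antitone nonnegative sequence. -/
lemma isLittleO_of_antitone_of_summable_sq {f : ℕ → ℝ} (hf : Antitone f) (h0 : ∀ k, 0 ≤ f k)
    (hs : Summable fun k => f k ^ 2) : f =o[atTop] fun k : ℕ => 1 / √(k : ℝ) := by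
  have hlim : Tendsto (fun k : ℕ => 2 * (∑ i ∈ Finset.range k, f i ^ 2 -
      ∑ i ∈ Finset.range (k / 2), f i ^ 2)) atTop (𝓝 0) := by
    have h1 := hs.hasSum.tendsto_sum_nat
    have h2 : Tendsto (fun k : ℕ => k / 2) atTop atTop :=
      tendsto_atTop_atTop.2 fun b => ⟨2 * b, fun a ha => by omega⟩
    simpa using (h1.sub (h1.comp h2)).const_mul 2
  -- The `k - k / 2` terms with index in `[k / 2, k)` are at least `f k ^ 2`.
  have hle : ∀ k : ℕ, k * f k ^ 2 ≤ 2 * (∑ i ∈ Finset.range k, f i ^ 2 -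
      ∑ i ∈ Finset.range (k / 2), f i ^ 2) := by
    intro k
    rw [← Finset.sum_Ico_eq_sub _ (Nat.div_le_self k 2)]
    have h1 : (k - k / 2 : ℕ) • f k ^ 2 ≤ ∑ i ∈ Finset.Ico (k / 2) k, f i ^ 2 := by
      rw [← Nat.card_Ico]
      refine Finset.card_nsmul_le_sum _ _ _ fun i hi => ?_
      exact pow_le_pow_left₀ (h0 k) (hf (Finset.mem_Ico.1 hi).2.le) 2
    have h2 : (k : ℝ) ≤ 2 * (k - k / 2 : ℕ) := by
      have : k ≤ 2 * (k - k / 2) := by omega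
      exact_mod_cast this
    rw [nsmul_eq_mul] at h1
    nlinarith [mul_le_mul_of_nonneg_right h2 (sq_nonneg (f k))]
  refine isLittleO_iff.2 fun c hc => ?_
  filter_upwards [hlim.eventually (gt_mem_nhds (pow_pos hc 2)), eventually_gt_atTop 0] with k hk hk0
  have hkpos : (0 : ℝ) < √(k : ℝ) := Real.sqrt_pos.2 (by exact_mod_cast hk0)
  rw [Real.norm_of_nonneg (h0 k), Real.norm_of_nonneg (by positivity), mul_one_div,
    le_div_iff₀ hkpos]
  refine abs_le_of_sq_le_sq' ?_ hc.le |>.2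
  rw [mul_pow, Real.sq_sqrt (Nat.cast_nonneg k)]
  linarith [hle k]

end Sequences

/-! ### The adaptive Douglas–Rachford iteration for a pair of resolvents -/

noncomputable section TwoResolvents

variable {E : Type*} [NormedAddCommGroup E] [InnerProductSpace ℝ E]

/-- The Yosida approximation of the operator whose (single-valued) resolvent with step `γ` is `J`. -/
def yosidaMap (γ : ℝ) (J : E → E) (x : E) : E := γ⁻¹ • (x - J x)

/-- `J` is the resolvent with step `γ` of a `σ`-comonotone operator, expressed through the points
`(J p, yosidaMap γ J p)` of its graph. -/
def IsComonotoneResolvent (γ σ : ℝ) (J : E → E) : Prop :=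
  ∀ p q, σ * ‖yosidaMap γ J p - yosidaMap γ J q‖ ^ 2 ≤
    ⟪J p - J q, yosidaMap γ J p - yosidaMap γ J q⟫

/-- The point `J₁ x - δ a`, with `a = yosidaMap γ J₁ x`, at which the second resolvent is evaluated.
It is the relaxed resolvent `(1 - lam) x + lam J₁ x` when `δ = γ (lam - 1)`. -/
def relaxedPoint (γ δ : ℝ) (J₁ : E → E) (x : E) : E := J₁ x - δ • yosidaMap γ J₁ x

/-- The sum `a + b` of the values `a ∈ A y`, `b ∈ B z` selected by one iteration from `x`. -/
def gap (γ δ : ℝ) (J₁ J₂ : E → E) (x : E) : E :=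
  yosidaMap γ J₁ x + yosidaMap δ J₂ (relaxedPoint γ δ J₁ x)

/-- One step of the adaptive Douglas–Rachford iteration; the factor is `κ (γ + δ)` because
`mu δ = γ + δ`. -/
def adrStep (κ γ δ : ℝ) (J₁ J₂ : E → E) (x : E) : E := x - (κ * (γ + δ)) • gap γ δ J₁ J₂ x

variable {κ γ δ α β : ℝ} {J₁ J₂ : E → E}

lemma inner_add_sub_eq_norm_sq_sub (a b : E) : ⟪a + b, a - b⟫ = ‖a‖ ^ 2 - ‖b‖ ^ 2 := by
  rw [inner_add_left, inner_sub_right, inner_sub_right, real_inner_self_eq_norm_sq,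
    real_inner_self_eq_norm_sq, real_inner_comm b a]
  ring

lemma apply_add_smul_yosidaMap (hγ : γ ≠ 0) (J : E → E) (x : E) :
    J x + γ • yosidaMap γ J x = x := by
  rw [yosidaMap, smul_inv_smul₀ hγ, add_sub_cancel]

lemma apply_relaxedPoint (J₁ J₂ : E → E) (hδ : δ ≠ 0) (x : E) :
    J₂ (relaxedPoint γ δ J₁ x) = J₁ x - δ • gap γ δ J₁ J₂ x := by
  have := apply_add_smul_yosidaMap hδ J₂ (relaxedPoint γ δ J₁ x)
  rw [gap, smul_add, ← sub_sub, eq_sub_iff_add_eq, this, relaxedPoint]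

/-- The quadratic form governing the iteration dominates `κ (γ + δ) / 2 * ‖a + b‖ ^ 2` with some
room to spare, and is moreover coercive in `a` if `α + β > 0`. -/
lemma exists_quadratic_bound (E : Type*) [NormedAddCommGroup E] [InnerProductSpace ℝ E]
    {lam mu : ℝ} (hγ : 0 < γ) (hδ : 0 < δ) (hαβ : 0 ≤ α + β)
    (hparam : ParameterConditions γ δ lam mu α β) (hκ : κ < kappaStar γ δ α β) :
    ∃ c η : ℝ, κ * (γ + δ) / 2 < c ∧ 0 ≤ η ∧ (0 < α + β → 0 < η) ∧
      ∀ a b : E, c * ‖a + b‖ ^ 2 + η * ‖a‖ ^ 2 ≤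
        (γ + α) * ‖a‖ ^ 2 + (γ + δ) * ⟪a, b⟫ + (δ + β) * ‖b‖ ^ 2 := by
  obtain ⟨-, -, h0, h1⟩ := hparam
  rcases hαβ.eq_or_lt with h | h
  · have hd := h0 h.symm
    rw [kappaStar, if_pos h.symm] at hκ
    refine ⟨(γ + δ) / 2, 0, by nlinarith, le_rfl, fun h' => absurd h h'.ne, fun a b => ?_⟩
    have e1 : γ + α = (γ + δ) / 2 := by linarith
    have e2 : δ + β = (γ + δ) / 2 := by linarith
    rw [e1, e2, norm_add_sq_real]
    exact le_of_eq (by ring)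
  · have hd := h1 h
    rw [kappaStar, if_neg h.ne'] at hκ
    have hlt : κ * (γ + δ) / 2 <
        (4 * (γ + α) * (δ + β) - (γ + δ) ^ 2) / (4 * (α + β)) := by
      rw [lt_div_iff₀ (by positivity)] at hκ ⊢
      linarith
    obtain ⟨c, hc1, hc2⟩ := exists_between hlt
    rw [lt_div_iff₀ (by positivity)] at hc2
    have hdisc : (γ + δ - 2 * c) ^ 2 < 4 * (γ + α - c) * (δ + β - c) := by linarith
    -- Both factors are positive since their product and their sum are.
    have hsum : 0 < (γ + α - c) + (δ + β - c) := by
      have : c * (4 * (α + β)) < (2 * (γ + δ) + (α + β)) * (α + β) := by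
        nlinarith [sq_nonneg ((γ + α) - (δ + β))]
      have : 4 * c < 2 * (γ + δ) + (α + β) := by
        by_contra! hcon
        nlinarith [mul_le_mul_of_nonneg_right hcon h.le]
      linarith
    have hprod : 0 < (γ + α - c) * (δ + β - c) := by nlinarith [sq_nonneg (γ + δ - 2 * c)]
    have hQ : 0 < δ + β - c := by
      by_contra! hcon
      rcases le_or_gt (γ + α - c) 0 with hP | hP
      · linarith
      · nlinarith [mul_nonpos_of_nonneg_of_nonpos hP.le hcon]
    set P := γ + α - c with hP
    set Q := δ + β - c with hQdef
    set S := γ + δ - 2 * c with hS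
    have hη : 0 < (4 * P * Q - S ^ 2) / (4 * Q) := div_pos (by linarith) (by positivity)
    refine ⟨c, (4 * P * Q - S ^ 2) / (4 * Q), hc1, hη.le, fun _ => hη, fun a b => ?_⟩
    have hsq := sq_nonneg ‖S • a + (2 * Q) • b‖
    rw [norm_add_sq_real, norm_smul, norm_smul, inner_smul_left, inner_smul_right, mul_pow, mul_pow,
      Real.norm_eq_abs, Real.norm_eq_abs, sq_abs, sq_abs, RCLike.conj_to_real] at hsq
    have e1 : (4 * P * Q - S ^ 2) / (4 * Q) * ‖a‖ ^ 2 * (4 * Q) =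
        (4 * P * Q - S ^ 2) * ‖a‖ ^ 2 := by field_simp
    have e2 : 0 ≤ (P * ‖a‖ ^ 2 + S * ⟪a, b⟫ + Q * ‖b‖ ^ 2 -
        (4 * P * Q - S ^ 2) / (4 * Q) * ‖a‖ ^ 2) * (4 * Q) := by
      rw [sub_mul, e1]; linarith
    have e3 := nonneg_of_mul_nonneg_left e2 (by positivity)
    rw [norm_add_sq_real]
    rw [hP, hQdef, hS] at e3 ⊢
    linarith

/-- The basic estimate of one step, a conical averagedness property of `adrStep`. -/
lemma exists_adrStep_estimate {lam mu : ℝ} (hκ0 : 0 < κ) (hγ : 0 < γ) (hδ : 0 < δ)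
    (hαβ : 0 ≤ α + β) (hparam : ParameterConditions γ δ lam mu α β)
    (hκ : κ < kappaStar γ δ α β) (h₁ : IsComonotoneResolvent γ α J₁)
    (h₂ : IsComonotoneResolvent δ β J₂) :
    ∃ ε ζ : ℝ, 0 < ε ∧ 0 ≤ ζ ∧ (0 < α + β → 0 < ζ) ∧ ∀ p q,
      ‖adrStep κ γ δ J₁ J₂ p - adrStep κ γ δ J₁ J₂ q‖ ^ 2 +
        (ε * ‖gap γ δ J₁ J₂ p - gap γ δ J₁ J₂ q‖ ^ 2 +
          ζ * ‖yosidaMap γ J₁ p - yosidaMap γ J₁ q‖ ^ 2) ≤ ‖p - q‖ ^ 2 := by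
  obtain ⟨c, η, hc, hη, hη', hquad⟩ := exists_quadratic_bound E hγ hδ hαβ hparam hκ
  have hS : 0 < κ * (γ + δ) := by positivity
  refine ⟨2 * (κ * (γ + δ)) * (c - κ * (γ + δ) / 2), 2 * (κ * (γ + δ)) * η,
    mul_pos (by positivity) (by linarith), by positivity,
    fun h => mul_pos (by positivity) (hη' h), fun p q => ?_⟩
  have hx : p - q = (J₁ p - J₁ q) + γ • (yosidaMap γ J₁ p - yosidaMap γ J₁ q) := by
    conv_lhs => rw [← apply_add_smul_yosidaMap hγ.ne' J₁ p, ← apply_add_smul_yosidaMap hγ.ne' J₁ q]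
    module
  have hz : J₂ (relaxedPoint γ δ J₁ p) - J₂ (relaxedPoint γ δ J₁ q) =
      (J₁ p - J₁ q) - δ • (gap γ δ J₁ J₂ p - gap γ δ J₁ J₂ q) := by
    rw [apply_relaxedPoint J₁ J₂ hδ.ne', apply_relaxedPoint J₁ J₂ hδ.ne']; module
  have hw : gap γ δ J₁ J₂ p - gap γ δ J₁ J₂ q = (yosidaMap γ J₁ p - yosidaMap γ J₁ q) +
      (yosidaMap δ J₂ (relaxedPoint γ δ J₁ p) - yosidaMap δ J₂ (relaxedPoint γ δ J₁ q)) := by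
    simp only [gap]; abel
  have hA := h₁ p q
  have hB := h₂ (relaxedPoint γ δ J₁ p) (relaxedPoint γ δ J₁ q)
  have hT : adrStep κ γ δ J₁ J₂ p - adrStep κ γ δ J₁ J₂ q =
      (p - q) - (κ * (γ + δ)) • (gap γ δ J₁ J₂ p - gap γ δ J₁ J₂ q) := by
    simp only [adrStep]; module
  rw [hz] at hB
  rw [hT]
  set w := gap γ δ J₁ J₂ p - gap γ δ J₁ J₂ q
  set a := yosidaMap γ J₁ p - yosidaMap γ J₁ q
  set b := yosidaMap δ J₂ (relaxedPoint γ δ J₁ p) - yosidaMap δ J₂ (relaxedPoint γ δ J₁ q)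
  set y := J₁ p - J₁ q
  have hq := hquad a b
  have hkey : c * ‖w‖ ^ 2 + η * ‖a‖ ^ 2 ≤ ⟪p - q, w⟫ := by
    rw [hw] at hB
    rw [hx, hw]
    refine hq.trans ?_
    simp only [inner_add_left, inner_add_right, inner_sub_left, inner_smul_left,
      RCLike.conj_to_real, real_inner_self_eq_norm_sq] at hB ⊢
    linarith
  rw [norm_sub_sq_real, inner_smul_right, norm_smul, mul_pow, Real.norm_eq_abs, sq_abs]
  nlinarith [mul_le_mul_of_nonneg_left hkey hS.le]

lemma IsComonotoneResolvent.norm_sub_le {σ : ℝ} {J : E → E} (h : IsComonotoneResolvent γ σ J)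
    (hγ : 0 < γ) (hγσ : 0 < γ + σ) (p q : E) :
    ‖J p - J q‖ ≤ (1 + γ / (γ + σ)) * ‖p - q‖ := by
  have h1 := h p q
  have hx : J p - J q = (p - q) - γ • (yosidaMap γ J p - yosidaMap γ J q) := by
    rw [eq_sub_of_add_eq (apply_add_smul_yosidaMap hγ.ne' J p),
      eq_sub_of_add_eq (apply_add_smul_yosidaMap hγ.ne' J q)]
    module
  rw [hx] at h1 ⊢
  set a := yosidaMap γ J p - yosidaMap γ J q
  have h2 : ‖a‖ ≤ ‖p - q‖ / (γ + σ) := by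
    rw [le_div_iff₀ hγσ]
    rw [inner_sub_left, inner_smul_left, real_inner_self_eq_norm_sq, RCLike.conj_to_real] at h1
    have h3 := real_inner_le_norm (p - q) a
    rcases (norm_nonneg a).eq_or_lt with h0 | h0
    · rw [← h0, zero_mul]; exact norm_nonneg _
    · exact le_of_mul_le_mul_right (by linarith : ‖a‖ * (γ + σ) * ‖a‖ ≤ ‖p - q‖ * ‖a‖) h0
  calc ‖p - q - γ • a‖ ≤ ‖p - q‖ + γ * ‖a‖ := by
        refine (_root_.norm_sub_le _ _).trans_eq ?_
        rw [norm_smul, Real.norm_of_nonneg hγ.le]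
    _ ≤ ‖p - q‖ + γ * (‖p - q‖ / (γ + σ)) := by gcongr
    _ = _ := by ring

/-- Demiclosedness: weak limits of `(x, J₁ x)` along which the gap vanishes strongly are zeros of
the gap together with their resolvents. The weak limit inequality is tested at the graph points
produced by the resolvents `J₁` and `J₂` from the limit itself. -/
lemma gap_eq_zero_of_weaklyTendsto {ι : Type*} {l : Filter ι} [l.NeBot] {x : ι → E} {x' y' : E}
    {C : ℝ} (hγ : 0 < γ) (hδ : 0 < δ) (hγα : 0 < γ + α) (hδβ : 0 < δ + β) (hαβ : 0 ≤ α + β)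
    (h₁ : IsComonotoneResolvent γ α J₁) (h₂ : IsComonotoneResolvent δ β J₂)
    (hC : ∀ᶠ i in l, ‖x i‖ ≤ C) (hC' : ∀ᶠ i in l, ‖J₁ (x i)‖ ≤ C)
    (hx : WeaklyTendsto x l x') (hy : WeaklyTendsto (fun i => J₁ (x i)) l y')
    (hw : Tendsto (fun i => gap γ δ J₁ J₂ (x i)) l (𝓝 0)) :
    y' = J₁ x' ∧ gap γ δ J₁ J₂ x' = 0 := by
  set a' := γ⁻¹ • (x' - y') with ha'
  set q := y' - δ • a' with hq
  set u := yosidaMap γ J₁ x' with hu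
  set v := yosidaMap δ J₂ q with hv
  let a : ι → E := fun i => yosidaMap γ J₁ (x i)
  let w : ι → E := fun i => gap γ δ J₁ J₂ (x i)
  have ha : WeaklyTendsto a l a' := (hx.sub hy).const_smul γ⁻¹
  have hyu : y' - J₁ x' = (-γ) • (a' - u) := by
    have h1 : y' + γ • a' = x' := by rw [ha', smul_inv_smul₀ hγ.ne', add_sub_cancel]
    have h2 := apply_add_smul_yosidaMap hγ.ne' J₁ x'
    have h3 : y' = x' - γ • a' := eq_sub_of_add_eq h1
    have h4 : J₁ x' = x' - γ • u := eq_sub_of_add_eq h2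
    rw [h4, h3]; module
  have hyv : y' - J₂ q = δ • (a' + v) := by
    have h2 := apply_add_smul_yosidaMap hδ.ne' J₂ q
    have h4 : J₂ q = q - δ • v := eq_sub_of_add_eq h2
    rw [h4, hq]; module
  -- The sum of the two comonotonicity inequalities. The quadratic terms `α ‖a i - u‖²` and
  -- `-α ‖w i - a i - v‖²` combine to a product with the strongly convergent `w i`, and the
  -- remaining `(α + β) ‖w i - a i - v‖²` is bounded below by its tangent.
  have hineq : ∀ i, 0 ≤ ⟪J₁ (x i), w i - u - v⟫ - ⟪J₁ x' - J₂ q, a i - u⟫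
      - ⟪J₂ q, w i - u - v⟫ - δ * ⟪w i, w i - a i - v⟫
      - α * ⟪2 • a i - u + v - w i, w i - u - v⟫
      - (α + β) * (‖a' + v‖ ^ 2 + 2 * ⟪a i - a' - w i, a' + v⟫) := by
    intro i
    have e1 := h₁ (x i) x'
    have e2 := h₂ (relaxedPoint γ δ J₁ (x i)) q
    have eb : yosidaMap δ J₂ (relaxedPoint γ δ J₁ (x i)) = w i - a i := by
      simp only [w, a, gap]; abel
    rw [eb, apply_relaxedPoint J₁ J₂ hδ.ne'] at e2
    change α * ‖a i - u‖ ^ 2 ≤ ⟪J₁ (x i) - J₁ x', a i - u⟫ at e1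
    change β * ‖w i - a i - v‖ ^ 2 ≤ ⟪J₁ (x i) - δ • w i - J₂ q, w i - a i - v⟫ at e2
    have e3 : ‖a' + v‖ ^ 2 + 2 * ⟪a i - a' - w i, a' + v⟫ ≤ ‖w i - a i - v‖ ^ 2 := by
      have h5 : w i - a i - v = -((a' + v) + (a i - a' - w i)) := by abel
      rw [h5, norm_neg, norm_add_sq_real (a' + v), real_inner_comm (a i - a' - w i)]
      linarith [sq_nonneg ‖a i - a' - w i‖]
    have e4 : α * ‖a i - u‖ ^ 2 - α * ‖w i - a i - v‖ ^ 2 =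
        α * ⟪2 • a i - u + v - w i, w i - u - v⟫ := by
      have h6 : w i - u - v = (a i - u) + (w i - a i - v) := by abel
      have h7 : 2 • a i - u + v - w i = (a i - u) - (w i - a i - v) := by rw [two_smul]; abel
      rw [h6, h7, real_inner_comm, inner_add_sub_eq_norm_sq_sub]
      ring
    have e5 := mul_le_mul_of_nonneg_left e3 hαβ
    have e6 : ⟪J₁ (x i) - J₁ x', a i - u⟫ + ⟪J₁ (x i) - δ • w i - J₂ q, w i - a i - v⟫ =
        ⟪J₁ (x i), w i - u - v⟫ - ⟪J₁ x' - J₂ q, a i - u⟫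
        - ⟪J₂ q, w i - u - v⟫ - δ * ⟪w i, w i - a i - v⟫ := by
      simp only [inner_sub_left, inner_sub_right, inner_smul_left, RCLike.conj_to_real]; ring
    linarith
  -- Passage to the limit.
  have hw0 : WeaklyTendsto w l 0 := weaklyTendsto_of_tendsto hw
  have hprod : ∀ {f : ι → E} {D : ℝ}, (∀ᶠ i in l, ‖f i‖ ≤ D) →
      Tendsto (fun i => ⟪f i, w i⟫) l (𝓝 0) := by
    intro f D hD
    refine squeeze_zero_norm' (a := fun i => D * ‖w i‖) ?_ (by simpa using hw.norm.const_mul D)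
    filter_upwards [hD] with i hi
    exact (norm_inner_le_norm _ _).trans (mul_le_mul_of_nonneg_right hi (norm_nonneg _))
  have hCa : ∀ᶠ i in l, ‖a i‖ ≤ ‖γ⁻¹‖ * (C + C) := by
    filter_upwards [hC, hC'] with i h1 h2
    simp only [a, yosidaMap]
    rw [norm_smul]
    exact mul_le_mul_of_nonneg_left ((norm_sub_le _ _).trans (add_le_add h1 h2)) (norm_nonneg _)
  have hyw := hprod hC'
  have haw := hprod hCa
  have hww : Tendsto (fun i => ⟪w i, w i⟫) l (𝓝 0) := by
    simpa only [inner_zero_left] using hw.inner (𝕜 := ℝ) hw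
  have hdot : ∀ t : E, Tendsto (fun i => ⟪w i, t⟫) l (𝓝 0) := fun t => by
    simpa using hw0 t
  have hlim : Tendsto (fun i => ⟪J₁ (x i), w i - u - v⟫ - ⟪J₁ x' - J₂ q, a i - u⟫
      - ⟪J₂ q, w i - u - v⟫ - δ * ⟪w i, w i - a i - v⟫
      - α * ⟪2 • a i - u + v - w i, w i - u - v⟫
      - (α + β) * (‖a' + v‖ ^ 2 + 2 * ⟪a i - a' - w i, a' + v⟫)) l
      (𝓝 (⟪y', -u - v⟫ - ⟪J₁ x' - J₂ q, a' - u⟫ - ⟪J₂ q, -u - v⟫ -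
        α * ⟪2 • a' - u + v, -u - v⟫ - (α + β) * ‖a' + v‖ ^ 2)) := by
    have t1 : Tendsto (fun i => ⟪J₁ (x i), w i - u - v⟫) l (𝓝 ⟪y', -u - v⟫) := by
      have := (hyw.sub (hy u)).sub (hy v)
      simpa only [inner_sub_right, inner_neg_right, zero_sub] using this
    have t2 : Tendsto (fun i => ⟪J₁ x' - J₂ q, a i - u⟫) l (𝓝 ⟪J₁ x' - J₂ q, a' - u⟫) := by
      simp_rw [real_inner_comm _ (J₁ x' - J₂ q)]
      have := (ha (J₁ x' - J₂ q)).sub_const ⟪u, J₁ x' - J₂ q⟫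
      simpa only [inner_sub_left] using this
    have t3 : Tendsto (fun i => ⟪J₂ q, w i - u - v⟫) l (𝓝 ⟪J₂ q, -u - v⟫) := by
      simp_rw [real_inner_comm _ (J₂ q)]
      have := ((hdot (J₂ q)).sub_const ⟪u, J₂ q⟫).sub_const ⟪v, J₂ q⟫
      simpa only [inner_sub_left, inner_neg_left, zero_sub] using this
    have t4 : Tendsto (fun i => ⟪w i, w i - a i - v⟫) l (𝓝 0) := by
      have := (hww.sub haw).sub (hdot v)
      simp only [sub_zero] at this
      refine this.congr fun i => ?_
      rw [inner_sub_right, inner_sub_right, real_inner_comm (w i) (a i)]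
    have t5 : Tendsto (fun i => ⟪2 • a i - u + v - w i, w i - u - v⟫) l
        (𝓝 ⟪2 • a' - u + v, -u - v⟫) := by
      have s1 : Tendsto (fun i => ⟪2 • a i - u + v - w i, w i⟫) l (𝓝 0) := by
        have := ((haw.const_mul 2).add (hdot (v - u))).sub hww
        simp only [mul_zero, add_zero, sub_zero] at this
        refine this.congr fun i => ?_
        rw [two_smul]
        simp only [inner_sub_left, inner_add_left, inner_sub_right, real_inner_comm (w i) u,
          real_inner_comm (w i) v]
        ring
      have s2 : ∀ t : E, Tendsto (fun i => ⟪2 • a i - u + v - w i, t⟫) l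
          (𝓝 ⟪2 • a' - u + v, t⟫) := fun t => by
        have := (((ha t).const_mul 2).add_const ⟪v - u, t⟫).sub (hdot t)
        have e : ⟪2 • a' - u + v, t⟫ = 2 * ⟪a', t⟫ + ⟪v - u, t⟫ - 0 := by
          rw [two_smul]; simp only [inner_sub_left, inner_add_left]; ring
        rw [e]
        refine this.congr fun i => ?_
        rw [two_smul]; simp only [inner_sub_left, inner_add_left]; ring
      have := (s1.sub (s2 u)).sub (s2 v)
      simpa only [inner_sub_right, inner_neg_right, zero_sub] using this
    have t6 : Tendsto (fun i => ⟪a i - a' - w i, a' + v⟫) l (𝓝 0) := by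
      have := ((ha (a' + v)).sub_const ⟪a', a' + v⟫).sub (hdot (a' + v))
      simpa only [inner_sub_left, sub_self, sub_zero] using this
    have := ((((t1.sub t2).sub t3).sub (t4.const_mul δ)).sub (t5.const_mul α)).sub
      (((t6.const_mul 2).const_add (‖a' + v‖ ^ 2)).const_mul (α + β))
    simpa only [mul_zero, sub_zero, add_zero] using this
  have hfin := ge_of_tendsto' hlim hineq
  have e1 : ⟪y', -u - v⟫ - ⟪J₁ x' - J₂ q, a' - u⟫ - ⟪J₂ q, -u - v⟫ =
      ⟪y' - J₁ x', a' - u⟫ - ⟪y' - J₂ q, a' + v⟫ := by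
    simp only [inner_sub_left, inner_sub_right, inner_neg_right, inner_add_right]; ring
  have e2 : α * ⟪2 • a' - u + v, -u - v⟫ = α * ‖a' - u‖ ^ 2 - α * ‖a' + v‖ ^ 2 := by
    have h6 : -u - v = (a' - u) - (a' + v) := by abel
    have h7 : 2 • a' - u + v = (a' - u) + (a' + v) := by rw [two_smul]; abel
    rw [h6, h7, inner_add_sub_eq_norm_sq_sub]
    ring
  rw [e1, e2, hyu, hyv, inner_smul_left, inner_smul_left, real_inner_self_eq_norm_sq,
    real_inner_self_eq_norm_sq, RCLike.conj_to_real, RCLike.conj_to_real] at hfin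
  have hs : (γ + α) * ‖a' - u‖ ^ 2 + (δ + β) * ‖a' + v‖ ^ 2 ≤ 0 := by linarith
  have p1 := mul_nonneg hγα.le (sq_nonneg ‖a' - u‖)
  have p2 := mul_nonneg hδβ.le (sq_nonneg ‖a' + v‖)
  have z1 : a' - u = 0 := by
    have : (γ + α) * ‖a' - u‖ ^ 2 = 0 := by linarith
    simpa [hγα.ne'] using this
  have z2 : a' + v = 0 := by
    have : (δ + β) * ‖a' + v‖ ^ 2 = 0 := by linarith
    simpa [hδβ.ne'] using this
  have z3 : y' = J₁ x' := by rw [z1, smul_zero] at hyu; exact sub_eq_zero.1 hyu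
  refine ⟨z3, ?_⟩
  have z4 : relaxedPoint γ δ J₁ x' = q := by rw [relaxedPoint, ← hu, hq, ← z3, ← sub_eq_zero.1 z1]
  rw [gap, z4, ← hu, ← sub_eq_zero.1 z1]
  exact z2

/-- Convergence of the adaptive Douglas–Rachford iteration for two comonotone resolvents. -/
theorem adrStep_converges [CompleteSpace E] {lam mu : ℝ} (hκ0 : 0 < κ) (hγ : 0 < γ) (hδ : 0 < δ)
    (hγα : 0 < γ + α) (hδβ : 0 < δ + β)
    (hαβ : 0 ≤ α + β) (hparam : ParameterConditions γ δ lam mu α β)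
    (hκ : κ < kappaStar γ δ α β) (h₁ : IsComonotoneResolvent γ α J₁)
    (h₂ : IsComonotoneResolvent δ β J₂) (hfix : ∃ p, gap γ δ J₁ J₂ p = 0) {x : ℕ → E}
    (hx : ∀ k, x (k + 1) = adrStep κ γ δ J₁ J₂ (x k)) :
    Tendsto (fun k => gap γ δ J₁ J₂ (x k)) atTop (𝓝 0) ∧
    (fun k => ‖x k - x (k + 1)‖) =o[atTop] (fun k : ℕ => 1 / √(k : ℝ)) ∧
    (fun k => ‖J₁ (x k) - J₁ (x (k + 1))‖) =o[atTop] (fun k : ℕ => 1 / √(k : ℝ)) ∧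
    (0 < α + β → ∀ p, gap γ δ J₁ J₂ p = 0 →
      Tendsto (fun k => yosidaMap γ J₁ (x k)) atTop (𝓝 (yosidaMap γ J₁ p))) ∧
    ∃ a, gap γ δ J₁ J₂ a = 0 ∧ WeaklyTendsto x atTop a ∧
      WeaklyTendsto (fun k => J₁ (x k)) atTop (J₁ a) := by
  obtain ⟨ε, ζ, hε, hζ, hζ', hest⟩ :=
    exists_adrStep_estimate hκ0 hγ hδ hαβ hparam hκ h₁ h₂
  have hS : 0 < κ * (γ + δ) := by positivity
  have hstep : ∀ p, gap γ δ J₁ J₂ p = 0 → ∀ k, ‖x (k + 1) - p‖ ^ 2 +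
      (ε * ‖gap γ δ J₁ J₂ (x k)‖ ^ 2 + ζ * ‖yosidaMap γ J₁ (x k) - yosidaMap γ J₁ p‖ ^ 2) ≤
        ‖x k - p‖ ^ 2 := by
    intro p hp k
    have h := hest (x k) p
    rwa [← hx, show adrStep κ γ δ J₁ J₂ p = p by rw [adrStep, hp, smul_zero, sub_zero], hp,
      sub_zero] at h
  have hr : ∀ p k, 0 ≤ ε * ‖gap γ δ J₁ J₂ (x k)‖ ^ 2 +
      ζ * ‖yosidaMap γ J₁ (x k) - yosidaMap γ J₁ p‖ ^ 2 := fun p k => by positivity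
  have hanti : ∀ p, gap γ δ J₁ J₂ p = 0 → Antitone fun k => ‖x k - p‖ ^ 2 := fun p hp =>
    antitone_nat_of_succ_le fun k => by linarith [hstep p hp k, hr p k]
  have hsum := fun p hp => summable_of_add_le (fun k => sq_nonneg ‖x k - p‖) (hr p) (hstep p hp)
  obtain ⟨p, hp⟩ := hfix
  have hsumw : Summable fun k => ‖gap γ δ J₁ J₂ (x k)‖ ^ 2 := by
    rw [← summable_mul_left_iff hε.ne']
    exact Summable.of_nonneg_of_le (fun k => by positivity)
      (fun k => le_add_of_nonneg_right (by positivity)) (hsum p hp)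
  have hgap : Tendsto (fun k => gap γ δ J₁ J₂ (x k)) atTop (𝓝 0) := by
    rw [tendsto_zero_iff_norm_tendsto_zero]
    simpa using hsumw.tendsto_atTop_zero.sqrt
  have hdiff : ∀ k, ‖x k - x (k + 1)‖ = κ * (γ + δ) * ‖gap γ δ J₁ J₂ (x k)‖ := fun k => by
    rw [hx, adrStep, sub_sub_cancel, norm_smul, Real.norm_of_nonneg hS.le]
  have hlo : (fun k => ‖x k - x (k + 1)‖) =o[atTop] (fun k : ℕ => 1 / √(k : ℝ)) := by
    refine isLittleO_of_antitone_of_summable_sq (antitone_nat_of_succ_le fun k => ?_)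
      (fun k => norm_nonneg _) ?_
    · refine abs_le_of_sq_le_sq' ?_ (norm_nonneg _) |>.2
      have h := hest (x k) (x (k + 1))
      rw [← hx, ← hx] at h
      refine le_trans ?_ h
      exact le_add_of_nonneg_right (by positivity)
    · simp_rw [hdiff, mul_pow]
      exact hsumw.mul_left _
  have hlip := h₁.norm_sub_le hγ hγα
  refine ⟨hgap, hlo, ?_, ?_, ?_⟩
  · refine IsBigO.trans_isLittleO (IsBigO.of_bound (1 + γ / (γ + α)) (.of_forall fun k => ?_)) hlo
    rw [norm_norm, norm_norm]
    exact hlip _ _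
  · intro ht q hq
    rw [tendsto_iff_norm_sub_tendsto_zero]
    have hs : Summable fun k => ‖yosidaMap γ J₁ (x k) - yosidaMap γ J₁ q‖ ^ 2 := by
      rw [← summable_mul_left_iff (hζ' ht).ne']
      exact Summable.of_nonneg_of_le (fun k => by positivity)
        (fun k => le_add_of_nonneg_left (by positivity)) (hsum q hq)
    simpa using hs.tendsto_atTop_zero.sqrt
  · have hbd : ∀ k, ‖x k - p‖ ≤ ‖x 0 - p‖ := fun k =>
      (abs_le_of_sq_le_sq' (hanti p hp (Nat.zero_le k)) (norm_nonneg _)).2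
    set C := max (‖x 0 - p‖ + ‖p‖) ((1 + γ / (γ + α)) * ‖x 0 - p‖ + ‖J₁ p‖) with hCdef
    have hC : ∀ k, ‖x k‖ ≤ C := fun k => by
      refine le_trans ?_ (le_max_left _ _)
      have := norm_sub_norm_le (x k) p
      linarith [hbd k]
    have hC' : ∀ k, ‖J₁ (x k)‖ ≤ C := fun k => by
      refine le_trans ?_ (le_max_right _ _)
      have h3 := norm_sub_norm_le (J₁ (x k)) (J₁ p)
      have h4 := hlip (x k) p
      have h5 := mul_le_mul_of_nonneg_left (hbd k)
        (by positivity : 0 ≤ 1 + γ / (γ + α))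
      linarith
    have hdemi : ∀ U : Ultrafilter ℕ, ↑U ≤ (atTop : Filter ℕ) → ∀ x' y',
        WeaklyTendsto x U x' → WeaklyTendsto (fun k => J₁ (x k)) U y' →
        y' = J₁ x' ∧ gap γ δ J₁ J₂ x' = 0 := fun U hU x' y' h3 h4 =>
      gap_eq_zero_of_weaklyTendsto hγ hδ hγα hδβ hαβ h₁ h₂ (.of_forall hC) (.of_forall hC') h3 h4
        (hgap.mono_left hU)
    obtain ⟨a, ha, hxa⟩ := exists_weaklyTendsto_of_opial (S := {q | gap γ δ J₁ J₂ q = 0}) hC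
      (fun q hq => ⟨_, tendsto_atTop_ciInf (hanti q hq)
        ⟨0, by rintro _ ⟨k, rfl⟩; exact sq_nonneg _⟩⟩)
      (fun U hU b hb => by
        obtain ⟨y', hy'⟩ := exists_weaklyTendsto U (.of_forall hC')
        exact (hdemi U hU b y' hb hy').2)
    exact ⟨a, ha, hxa, weaklyTendsto_of_ultrafilter (.of_forall hC') fun U hU b hb =>
      (hdemi U hU a b (hxa.mono hU) hb).1⟩

end TwoResolvents

/-! ### Translation to set-valued operators -/

section SetValued

variable {E : Type*} [NormedAddCommGroup E] [InnerProductSpace ℝ E]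
  {κ γ δ α β lam mu : ℝ} {F G : E → Set E} {J₁ J₂ : E → E}

lemma yosidaMap_mem (hγ : γ ≠ 0) {J : E → E} (hJ : ∀ p, setResolvent γ F p = {J p}) (p : E) :
    yosidaMap γ J p ∈ F (J p) :=
  (mem_setResolvent hγ).1 (by rw [hJ]; rfl)

lemma IsComonotone.isComonotoneResolvent (hF : IsComonotone α F) (hγ : γ ≠ 0) {J : E → E}
    (hJ : ∀ p, setResolvent γ F p = {J p}) : IsComonotoneResolvent γ α J := fun p q =>
  hF _ _ (yosidaMap_mem hγ hJ p) _ _ (yosidaMap_mem hγ hJ q)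

lemma resolvent_apply_add_smul (hγ : γ ≠ 0) {J : E → E} (hJ : ∀ p, setResolvent γ F p = {J p}) {y u : E}
    (hu : u ∈ F y) : J (y + γ • u) = y := by
  have : y ∈ setResolvent γ F (y + γ • u) := by
    rwa [mem_setResolvent hγ, add_sub_cancel_left, inv_smul_smul₀ hγ]
  rw [hJ] at this
  exact this.symm

/-- The zeros of `F + G` are the images under `J₁` of the zeros of the gap; a zero `p` with
`u ∈ F p` and `-u ∈ G p` comes from the point `p + γ u`. -/
lemma mem_zeros_add_iff (hγ : γ ≠ 0) (hδ : δ ≠ 0) (hJ₁ : ∀ p, setResolvent γ F p = {J₁ p})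
    (hJ₂ : ∀ p, setResolvent δ G p = {J₂ p}) {p : E} :
    p ∈ zeros (fun x => F x + G x) ↔ ∃ x, gap γ δ J₁ J₂ x = 0 ∧ J₁ x = p := by
  constructor
  · rintro ⟨u, hu, v, hv, huv⟩
    have hv' : v = -u := (neg_eq_of_add_eq_zero_right huv).symm
    subst hv'
    have h1 := resolvent_apply_add_smul hγ hJ₁ hu
    have h2 := resolvent_apply_add_smul hδ hJ₂ hv
    have h3 : yosidaMap γ J₁ (p + γ • u) = u := by
      rw [yosidaMap, h1, add_sub_cancel_left, inv_smul_smul₀ hγ]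
    have h4 : relaxedPoint γ δ J₁ (p + γ • u) = p + δ • -u := by
      rw [relaxedPoint, h1, h3, smul_neg, sub_eq_add_neg]
    refine ⟨p + γ • u, ?_, h1⟩
    rw [gap, h3, h4, yosidaMap, h2, add_sub_cancel_left, inv_smul_smul₀ hδ, add_neg_cancel]
  · rintro ⟨x, hx, rfl⟩
    have h1 := yosidaMap_mem hγ hJ₁ x
    have h2 := yosidaMap_mem hδ hJ₂ (relaxedPoint γ δ J₁ x)
    rw [apply_relaxedPoint J₁ J₂ hδ, hx, smul_zero, sub_zero] at h2
    exact ⟨_, h1, _, h2, hx⟩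

lemma relaxedPoint_eq (hγ : γ ≠ 0) (h : δ = γ * (lam - 1)) (x : E) :
    relaxedPoint γ δ J₁ x = (1 - lam) • x + lam • J₁ x := by
  rw [relaxedPoint, yosidaMap, smul_smul, h, mul_right_comm, mul_inv_cancel₀ hγ]
  module

lemma mul_eq_add_of_relaxation (hlm : (lam - 1) * (mu - 1) = 1) (h : δ = γ * (lam - 1)) : mu * δ = γ + δ := by
  rw [h]; linear_combination γ * hlm

/-- On operators with single-valued resolvents the Douglas–Rachford operator is the map `adrStep`. -/
lemma adrOperator_eq (hγ : γ ≠ 0) (hδ : δ ≠ 0) (hJ₁ : ∀ p, setResolvent γ F p = {J₁ p})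
    (hJ₂ : ∀ p, setResolvent δ G p = {J₂ p}) (hlm : (lam - 1) * (mu - 1) = 1)
    (h : δ = γ * (lam - 1)) (x : E) :
    adrOperator κ γ δ lam mu F G x = {adrStep κ γ δ J₁ J₂ x} := by
  have h1 : relaxedResolvent γ lam F x = {relaxedPoint γ δ J₁ x} := by
    rw [relaxedResolvent, hJ₁, Set.smul_set_singleton, Set.singleton_add_singleton, add_comm,
      relaxedPoint_eq hγ h]
  rw [adrOperator, h1, Set.biUnion_singleton, relaxedResolvent, hJ₂, Set.smul_set_singleton,
    Set.singleton_add_singleton, Set.smul_set_singleton, Set.singleton_add_singleton,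
    Set.singleton_eq_singleton_iff]
  have h2 := apply_relaxedPoint J₁ J₂ hδ (γ := γ) x
  have h3 : mu • J₂ (relaxedPoint γ δ J₁ x) + (1 - mu) • relaxedPoint γ δ J₁ x =
      x - (γ + δ) • gap γ δ J₁ J₂ x := by
    have h4 : (1 - mu) • relaxedPoint γ δ J₁ x = x - mu • J₁ x := by
      rw [relaxedPoint_eq hγ h, smul_add, smul_smul, smul_smul,
        show (1 - mu) * (1 - lam) = 1 by linear_combination hlm,
        show (1 - mu) * lam = -mu by linear_combination -hlm]
      module
    rw [h2, h4, ← mul_eq_add_of_relaxation hlm h]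
    module
  rw [h3, adrStep]
  module

lemma mem_fixedPoints_adrOperator_iff (hκ : 0 < κ) (hγ : 0 < γ) (hδ : 0 < δ)
    (hJ₁ : ∀ p, setResolvent γ F p = {J₁ p})
    (hJ₂ : ∀ p, setResolvent δ G p = {J₂ p}) (hlm : (lam - 1) * (mu - 1) = 1)
    (h : δ = γ * (lam - 1)) (x : E) :
    x ∈ fixedPoints (adrOperator κ γ δ lam mu F G) ↔ gap γ δ J₁ J₂ x = 0 := by
  have hS : κ * (γ + δ) ≠ 0 := by positivity
  rw [fixedPoints, Set.mem_ofPred_eq, adrOperator_eq hγ.ne' hδ.ne' hJ₁ hJ₂ hlm h,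
    Set.mem_singleton_iff, adrStep, eq_comm, sub_eq_self, smul_eq_zero, or_iff_right hS]

lemma smul_yosida_eq (hγ : γ ≠ 0) (hJ₁ : ∀ p, setResolvent γ F p = {J₁ p}) (x : E) :
    γ • yosida γ F x = {x - J₁ x} := by
  rw [yosida, hJ₁, Set.singleton_sub_singleton, Set.smul_set_singleton, Set.smul_set_singleton,
    one_div, smul_inv_smul₀ hγ]

/-- The convergence theorem for two comonotone operators with single-valued, everywhere defined
resolvents. -/
theorem IsADRSequence.converges [CompleteSpace E] (hF : IsComonotone α F) (hG : IsComonotone β G)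
    (hκ0 : 0 < κ) (hγ : 0 < γ) (hδ : 0 < δ) (hαβ : 0 ≤ α + β) (hγα : 0 < γ + α) (hδβ : 0 < δ + β)
    (hparam : ParameterConditions γ δ lam mu α β) (hκ : κ < kappaStar γ δ α β)
    (hJF : ∀ p, ∃ q, setResolvent γ F p = {q}) (hJG : ∀ p, ∃ q, setResolvent δ G p = {q})
    (hzer : (zeros fun x => F x + G x).Nonempty) {x y z : ℕ → E}
    (hxyz : IsADRSequence κ γ δ lam mu F G x y z) :
    ∃ xbar pbar : E,
      (xbar ∈ fixedPoints (adrOperator κ γ δ lam mu F G) ∧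
        setResolvent γ F xbar = {pbar} ∧
        pbar ∈ zeros (fun x => F x + G x) ∧
        WeaklyConverges x xbar) ∧
      ((fun k => ‖x k - x (k + 1)‖) =o[atTop] (fun k : ℕ => 1 / √(k : ℝ)) ∧
        (fun k => ‖y k - y (k + 1)‖) =o[atTop] (fun k : ℕ => 1 / √(k : ℝ))) ∧
      (WeaklyConverges y pbar ∧ WeaklyConverges z pbar) ∧
      (0 < α + β →
        γ • yosida γ F xbar = {xbar - pbar} ∧
        Tendsto (fun k => x k - y k) atTop (𝓝 (xbar - pbar)) ∧
        Tendsto (fun k => x k - z k) atTop (𝓝 (xbar - pbar)) ∧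
        γ • yosida γ F xbar + zeros (fun x => F x + G x) =
          fixedPoints (adrOperator κ γ δ lam mu F G)) := by
  choose J₁ hJ₁ using hJF
  choose J₂ hJ₂ using hJG
  obtain ⟨hlm, hδγ, -⟩ := id hparam
  have h₁ := hF.isComonotoneResolvent hγ.ne' hJ₁
  have h₂ := hG.isComonotoneResolvent hδ.ne' hJ₂
  have hzer' : ∀ {p}, p ∈ zeros (fun x => F x + G x) ↔ ∃ x, gap γ δ J₁ J₂ x = 0 ∧ J₁ x = p :=
    mem_zeros_add_iff hγ.ne' hδ.ne' hJ₁ hJ₂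
  have hfix := mem_fixedPoints_adrOperator_iff hκ0 hγ hδ hJ₁ hJ₂ hlm hδγ
  have hy : y = fun k => J₁ (x k) := funext fun k => by
    have := (hxyz k).1
    rwa [hJ₁] at this
  have hz : z = fun k => J₁ (x k) - δ • gap γ δ J₁ J₂ (x k) := funext fun k => by
    have := (hxyz k).2.1
    rw [hJ₂, hy, ← relaxedPoint_eq hγ.ne' hδγ, apply_relaxedPoint J₁ J₂ hδ.ne'] at this
    exact this
  have hx : ∀ k, x (k + 1) = adrStep κ γ δ J₁ J₂ (x k) := fun k => by
    rw [(hxyz k).2.2, hy, hz, adrStep, ← mul_eq_add_of_relaxation hlm hδγ]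
    module
  obtain ⟨q, hq⟩ := hzer
  obtain ⟨p, hp, -⟩ := hzer'.1 hq
  obtain ⟨hgap, hlo, hlo', hyos, a, ha, hxa, hya⟩ :=
    adrStep_converges hκ0 hγ hδ hγα hδβ hαβ hparam hκ h₁ h₂ ⟨p, hp⟩ hx
  have hgap' : Tendsto (fun k => δ • gap γ δ J₁ J₂ (x k)) atTop (𝓝 0) := by
    simpa using hgap.const_smul δ
  have hxJ : ∀ t, t - J₁ t = γ • yosidaMap γ J₁ t := fun t => by
    rw [yosidaMap, smul_inv_smul₀ hγ.ne']
  refine ⟨a, J₁ a, ⟨(hfix a).2 ha, hJ₁ a, hzer'.2 ⟨a, ha, rfl⟩, weaklyConverges_iff.2 hxa⟩,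
    ⟨hlo, by rw [hy]; exact hlo'⟩, ⟨weaklyConverges_iff.2 (by rw [hy]; exact hya),
      weaklyConverges_iff.2 ?_⟩, fun ht => ?_⟩
  · rw [hz]
    simpa using hya.sub (weaklyTendsto_of_tendsto hgap')
  have hdiff : Tendsto (fun k => x k - y k) atTop (𝓝 (a - J₁ a)) := by
    simp_rw [hy, hxJ]
    exact (hyos ht a ha).const_smul γ
  refine ⟨smul_yosida_eq hγ.ne' hJ₁ a, hdiff, ?_, ?_⟩
  · have := hdiff.add hgap'
    rw [add_zero] at this
    refine this.congr fun k => ?_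
    rw [hy, hz]; module
  -- All zeros of the gap have the same Yosida value, the strong limit along the iteration.
  have huniq : ∀ t, gap γ δ J₁ J₂ t = 0 → t - J₁ t = a - J₁ a := fun t ht' => by
    rw [hxJ, hxJ, tendsto_nhds_unique (hyos ht t ht') (hyos ht a ha)]
  rw [smul_yosida_eq hγ.ne' hJ₁ a]
  ext t
  rw [hfix, Set.singleton_add, Set.mem_image]
  constructor
  · rintro ⟨s, hs, rfl⟩
    obtain ⟨t, ht', rfl⟩ := hzer'.1 hs
    rwa [← huniq t ht', sub_add_cancel]
  · exact fun ht' => ⟨J₁ t, hzer'.2 ⟨t, ht', rfl⟩, by rw [← huniq t ht', sub_add_cancel]⟩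

end SetValued

/-! ### The product space reformulation -/

section Product

variable {H : Type*} [NormedAddCommGroup H] [InnerProductSpace ℝ H] {n : ℕ}

lemma inner_constVec_left (a : H) (w : ProdSpace H n) : ⟪constVec n a, w⟫ = ⟪a, ∑ i, w i⟫ := by
  rw [PiLp.inner_apply, inner_sum]; rfl

lemma mem_normalCone_diagonal {a : H} {w : ProdSpace H n} :
    w ∈ normalCone (diagonal H n) (constVec n a) ↔ ∑ i, w i = 0 := by
  have key : ∀ b, ⟪w, constVec n b - constVec n a⟫ = ⟪b - a, ∑ i, w i⟫ := fun b => by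
    rw [inner_sub_right, real_inner_comm, real_inner_comm (constVec n a), inner_constVec_left,
      inner_constVec_left, inner_sub_left]
  constructor
  · rintro ⟨-, h⟩
    have h1 := h _ ⟨a + ∑ i, w i, rfl⟩
    rw [key, add_sub_cancel_left, real_inner_self_eq_norm_sq] at h1
    have h2 : ‖∑ i, w i‖ ^ 2 = 0 := le_antisymm h1 (sq_nonneg _)
    simpa using h2
  · rintro h
    refine ⟨⟨a, rfl⟩, ?_⟩
    rintro _ ⟨b, rfl⟩
    rw [key, h, inner_zero_right]

lemma mem_opG_iff (hn : 1 ≤ n) {A : Fin (n + 1) → H → Set H} {x w : ProdSpace H n} :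
    w ∈ opG A x ↔ ∃ a, x = constVec n a ∧ ∑ i, w i ∈ A (Fin.last n) a := by
  have hn0 : (n : ℝ) ≠ 0 := by exact_mod_cast (by omega : n ≠ 0)
  have hsum : ∀ v : H, ∑ i, ((1 / (n : ℝ)) • constVec n v) i = v := fun v => by
    simp only [constVec, PiLp.smul_apply, Finset.sum_const, Finset.card_univ, Fintype.card_fin]
    rw [← Nat.cast_smul_eq_nsmul ℝ, smul_smul, mul_one_div_cancel hn0, one_smul]
  constructor
  · rintro ⟨k, ⟨a, v, rfl, hv, rfl⟩, m, hm, rfl⟩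
    refine ⟨a, rfl, ?_⟩
    rw [mem_normalCone_diagonal] at hm
    simp_rw [PiLp.add_apply]
    rwa [Finset.sum_add_distrib, hsum, hm, add_zero]
  · rintro ⟨a, rfl, hw⟩
    refine ⟨_, ⟨a, _, rfl, hw, rfl⟩, w - (1 / (n : ℝ)) • constVec n (∑ i, w i), ?_,
      add_sub_cancel _ _⟩
    rw [mem_normalCone_diagonal]
    simp_rw [PiLp.sub_apply]
    rw [Finset.sum_sub_distrib, hsum, sub_self]

lemma isComonotone_opF {A : Fin (n + 1) → H → Set H} {σ : Fin (n + 1) → ℝ} {α : ℝ}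
    (hA : ∀ i : Fin n, IsComonotone (σ i.castSucc) (A i.castSucc))
    (hα : ∀ i : Fin n, α ≤ σ i.castSucc) : IsComonotone α (opF A) := by
  intro x u hu y v hv
  rw [PiLp.inner_apply, PiLp.norm_sq_eq_of_L2, Finset.mul_sum]
  refine Finset.sum_le_sum fun i _ => ?_
  exact (mul_le_mul_of_nonneg_right (hα i) (sq_nonneg _)).trans
    (hA i _ _ (hu i) _ _ (hv i))

lemma isComonotone_opG (hn : 1 ≤ n) {A : Fin (n + 1) → H → Set H} {τ : ℝ}
    (hA : IsComonotone τ (A (Fin.last n))) (hτ : τ ≤ 0) :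
    IsComonotone (n * τ) (opG A) := by
  intro x u hu y v hv
  obtain ⟨a, rfl, hu'⟩ := (mem_opG_iff hn).1 hu
  obtain ⟨b, rfl, hv'⟩ := (mem_opG_iff hn).1 hv
  have h1 := hA _ _ hu' _ _ hv'
  have h2 : ∑ i, u i - ∑ i, v i = ∑ i, (u - v) i := by
    simp_rw [PiLp.sub_apply]; rw [Finset.sum_sub_distrib]
  have h3 : ⟪constVec n a - constVec n b, u - v⟫ = ⟪a - b, ∑ i, (u - v) i⟫ := by
    rw [inner_sub_left, inner_constVec_left, inner_constVec_left, inner_sub_left]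
  have h4 : ‖∑ i, (u - v) i‖ ^ 2 ≤ n * ‖u - v‖ ^ 2 := by
    rw [PiLp.norm_sq_eq_of_L2]
    calc ‖∑ i, (u - v) i‖ ^ 2 ≤ (∑ i, ‖(u - v) i‖) ^ 2 :=
          pow_le_pow_left₀ (norm_nonneg _) (norm_sum_le _ _) 2
      _ ≤ _ := by
          simpa using sq_sum_le_card_mul_sum_sq (s := Finset.univ) (f := fun i => ‖(u - v) i‖)
  rw [h2] at h1
  rw [h3]
  nlinarith [mul_le_mul_of_nonpos_left h4 hτ]

lemma exists_setResolvent_opF_eq [CompleteSpace H] {A : Fin (n + 1) → H → Set H}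
    {σ : Fin (n + 1) → ℝ} {α γ : ℝ} (hA : ∀ i, IsMaximalComonotone (σ i) (A i))
    (hα : ∀ i : Fin n, α ≤ σ i.castSucc) (hγ : 0 < γ) (hγα : 0 < γ + α) (p : ProdSpace H n) :
    ∃ q, setResolvent γ (opF A) p = {q} := by
  choose q hq using fun i : Fin n => (hA i.castSucc).exists_mem_setResolvent hγ
    (by linarith [hα i]) (p i)
  refine ⟨WithLp.toLp 2 q, ((isComonotone_opF (fun i => (hA i.castSucc).1)
    hα).setResolvent_subsingleton hγ hγα p).eq_singleton_of_mem ?_⟩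
  rw [mem_setResolvent hγ.ne']
  exact fun i => (mem_setResolvent hγ.ne').1 (hq i)

/-- The resolvent of `𝐆` at `p` is the constant vector of the resolvent of the last operator, with
step `δ / n`, at the mean of `p`. -/
lemma exists_setResolvent_opG_eq [CompleteSpace H] (hn : 1 ≤ n) {A : Fin (n + 1) → H → Set H}
    {τ δ : ℝ} (hA : IsMaximalComonotone τ (A (Fin.last n))) (hτ : τ ≤ 0) (hδ : 0 < δ)
    (hδτ : 0 < δ + n * τ) (p : ProdSpace H n) : ∃ q, setResolvent δ (opG A) p = {q} := by
  have hn0 : (0 : ℝ) < n := by exact_mod_cast hn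
  obtain ⟨a, ha⟩ := hA.exists_mem_setResolvent (γ := δ / n) (by positivity)
    (by
      have : δ / n + τ = (δ + n * τ) / n := by field_simp
      rw [this]; positivity) ((1 / (n : ℝ)) • ∑ i, p i)
  rw [mem_setResolvent (by positivity)] at ha
  refine ⟨constVec n a, ((isComonotone_opG hn hA.1 hτ).setResolvent_subsingleton hδ hδτ
    p).eq_singleton_of_mem ?_⟩
  rw [mem_setResolvent hδ.ne', mem_opG_iff hn]
  refine ⟨a, rfl, ?_⟩
  convert ha using 1
  have h1 : ∑ i, (δ⁻¹ • (p - constVec n a)) i = δ⁻¹ • (∑ i, p i - (n : ℝ) • a) := by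
    simp [constVec, ← Finset.smul_sum, Finset.sum_sub_distrib, Nat.cast_smul_eq_nsmul]
  rw [h1, smul_sub, smul_sub, smul_smul, smul_smul]
  congr 2 <;> field_simp

/-- If `∑ i, g i = 0` with `g i ∈ A i a`, then `(g 0, …, g (n - 1))` and its negative are values of
`𝐅` and `𝐆` at `(a, …, a)`. -/
lemma zeros_opF_add_opG_nonempty (hn : 1 ≤ n) {A : Fin (n + 1) → H → Set H}
    (hzer : (zeros fun x => ∑ i, A i x).Nonempty) :
    (zeros fun x => opF A x + opG A x).Nonempty := by
  obtain ⟨a, ha⟩ := hzer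
  obtain ⟨g, hg, hsum⟩ := (Set.mem_fintype_sum _ _).1 (show (0 : H) ∈ ∑ i, A i a from ha)
  rw [Fin.sum_univ_castSucc] at hsum
  let u : ProdSpace H n := WithLp.toLp 2 fun i => g i.castSucc
  refine ⟨constVec n a, u, fun i => hg i.castSucc, -u, (mem_opG_iff hn).2 ⟨a, rfl, ?_⟩,
    add_neg_cancel u⟩
  have : ∑ i, (-u) i = g (Fin.last n) := by
    simp_rw [PiLp.neg_apply]
    rw [Finset.sum_neg_distrib]
    exact neg_eq_of_add_eq_zero_right hsum
  rw [this]
  exact hg _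

end Product

/-- The parameter conditions make both resolvents well defined. -/
lemma ParameterConditions.add_pos {γ δ lam mu α β : ℝ}
    (h : ParameterConditions γ δ lam mu α β) (hγ : 0 < γ) (hδ : 0 < δ) (hαβ : 0 ≤ α + β) :
    0 < γ + α ∧ 0 < δ + β := by
  obtain ⟨-, -, h0, h1⟩ := h
  rcases hαβ.eq_or_lt with hs | hs
  · have := h0 hs.symm
    constructor <;> linarith
  · -- The product of the two numbers and their sum are positive.
    have hp := h1 hs
    have hpos : 0 < (γ + α) * (δ + β) := by nlinarith [sq_nonneg (γ + δ)]
    rcases pos_and_pos_or_neg_and_neg_of_mul_pos hpos with h | ⟨h, h'⟩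
    · exact h
    · linarith

end AdaptiveDR

/-- There are `m = n + 1 ≥ 2` operators, indexed by `Fin (n + 1)`: `A i.castSucc` for `i : Fin n`
are the first `m - 1` of them and `A (Fin.last n)` is the last one; `n = m - 1`. -/
theorem mainTheorem5 {H : Type*} [NormedAddCommGroup H] [InnerProductSpace ℝ H] [CompleteSpace H]
    (n : ℕ) (hn : 1 ≤ n)
    (A : Fin (n + 1) → H → Set H) (σ : Fin (n + 1) → ℝ)
    (hA : ∀ i, IsMaximalComonotone (σ i) (A i))
    (hzer : (zeros fun x => ∑ i, A i x).Nonempty)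
    (hσlast : σ (Fin.last n) ≤ 0)
    (hσ : ∀ i : Fin n, 0 ≤ σ i.castSucc + n * σ (Fin.last n))
    (α β : ℝ) (hα : α = ⨅ i : Fin n, σ i.castSucc) (hβ : β = n * σ (Fin.last n))
    (κ γ δ lam mu : ℝ) (hκ : 0 < κ) (hγ : 0 < γ) (hδ : 0 < δ) (hlam : 0 < lam) (hmu : 0 < mu)
    (hparam : ParameterConditions γ δ lam mu α β)
    (hκstar : κ < kappaStar γ δ α β) :
    (∀ p, ∃ q, setResolvent γ (opF A) p = {q}) ∧
    (∀ p, ∃ q, setResolvent δ (opG A) p = {q}) ∧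
    ∀ x y z : ℕ → ProdSpace H n,
      IsADRSequence κ γ δ lam mu (opF A) (opG A) x y z →
      ∃ xbar pbar : ProdSpace H n,
        (xbar ∈ fixedPoints (adrOperator κ γ δ lam mu (opF A) (opG A)) ∧
          setResolvent γ (opF A) xbar = {pbar} ∧
          pbar ∈ zeros (fun x => opF A x + opG A x) ∧
          WeaklyConverges x xbar) ∧
        ((fun k => ‖x k - x (k + 1)‖) =o[atTop] (fun k : ℕ => 1 / √(k : ℝ)) ∧
          (fun k => ‖y k - y (k + 1)‖) =o[atTop] (fun k : ℕ => 1 / √(k : ℝ))) ∧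
        (WeaklyConverges y pbar ∧ WeaklyConverges z pbar) ∧
        ((∀ i : Fin n, 0 < σ i.castSucc + n * σ (Fin.last n)) → κ < 1 →
          (1 ≤ kappaStar γ δ α β ∨
            (γ = δ ∧ lam = 2 ∧ mu = 2 ∧ κ < kappaStar γ δ α β)) →
          γ • yosida γ (opF A) xbar = {xbar - pbar} ∧
          Tendsto (fun k => x k - y k) atTop (𝓝 (xbar - pbar)) ∧
          Tendsto (fun k => x k - z k) atTop (𝓝 (xbar - pbar)) ∧
          γ • yosida γ (opF A) xbar + zeros (fun x => opF A x + opG A x) =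
            fixedPoints (adrOperator κ γ δ lam mu (opF A) (opG A))) := by
  have : Nonempty (Fin n) := ⟨⟨0, hn⟩⟩
  have hle : ∀ i : Fin n, α ≤ σ i.castSucc := fun i => hα ▸ ciInf_le (Set.finite_range _).bddBelow i
  obtain ⟨i₀, hi₀⟩ := exists_eq_ciInf_of_finite (f := fun i : Fin n => σ i.castSucc)
  have hαβ : α + β = σ i₀.castSucc + n * σ (Fin.last n) := by rw [hα, hβ, ← hi₀]
  have hαβ0 : 0 ≤ α + β := hαβ ▸ hσ i₀
  obtain ⟨hγα, hδβ⟩ := hparam.add_pos hγ hδ hαβ0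
  have hJF := exists_setResolvent_opF_eq hA hle hγ hγα
  have hJG := exists_setResolvent_opG_eq hn (hA (Fin.last n)) hσlast hδ (hβ ▸ hδβ)
  refine ⟨hJF, hJG, fun x y z hxyz => ?_⟩
  obtain ⟨xbar, pbar, h1, h2, h3, h4⟩ := IsADRSequence.converges
    (isComonotone_opF (fun i => (hA i.castSucc).1) hle)
    (hβ ▸ isComonotone_opG hn (hA (Fin.last n)).1 hσlast) hκ hγ hδ hαβ0 hγα hδβ hparam hκstar
    hJF hJG (zeros_opF_add_opG_nonempty hn hzer) hxyz
  exact ⟨xbar, pbar, h1, h2, h3, fun hpos _ _ => h4 (hαβ ▸ hpos i₀)⟩
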